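/- Let $\mathfrak g_{\mathbb C}$ be a finite-dimensional complex semisimple Lie algebra, $\mathfrak t_{\mathbb C}\subset\mathfrak g_{\mathbb C}$ a Cartan subalgebra, $\Lambda_{\mathrm{rt}}\subset\mathfrak t_{\mathbb C}^*$ the root lattice, and let $\mathtt T\in\mathrm{Hom}(\Lambda_{\mathrm{rt}},\mathbb Z)$ be a grading element, that is, an element $\mathtt T\in\mathfrak t_{\mathbb C}$ with $\alpha(\mathtt T)\in\mathbb Z$ for every root $\alpha$. For $\ell\in\mathbb Z$ put $\mathfrak g_\ell=\{x\in\mathfrak g_{\mathbb C} : [\mathtt T,x]=\ell x\}$, $\mathfrak g_{\mathrm{even}}=\bigoplus_{\ell}\mathfrak g_{2\ell}$ and $\mathfrak g_{\mathrm{odd}}=\bigoplus_{\ell}\mathfrak g_{2\ell+1}$. Then there exist a real form $\mathfrak g_{\mathbb R}$ of $\mathfrak g_{\mathbb C}$ that is defined over $\mathbb Z$ (there is a finitely generated subgroup $\mathfrak g_{\mathbb Z}\subset\mathfrak g_{\mathbb R}$, closed under the bracket, with $\mathfrak g_{\mathbb Z}\otimes_{\mathbb Z}\mathbb R=\mathfrak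 g_{\mathbb R}$), a Cartan subalgebra $\mathfrak t\subset\mathfrak g_{\mathbb R}$ with complexification $\mathfrak t_{\mathbb C}$, and a Cartan decomposition $\mathfrak g_{\mathbb R}=\mathfrak k_{\mathbb R}\oplus\mathfrak q_{\mathbb R}$ such that $\mathfrak t\subset\mathfrak k_{\mathbb R}$ and the torus $\exp(\mathrm{ad}\,\mathfrak t)$ is compact, $\mathfrak k_{\mathbb R}\otimes\mathbb C=\mathfrak g_{\mathrm{even}}$ and $\mathfrak q_{\mathbb R}\otimes\mathbb C=\mathfrak g_{\mathrm{odd}}$. In particular, let $G_{\mathrm{ad}}$ be the connected adjoint group of $\mathfrak g_{\mathbb R}$. Then $\mathtt L=4\pi\mathbf i\,\mathtt T$ lies in $\mathfrak t$, there is a circle $\varphi:S^1\to G_{\mathrm{ad}}$ with $\varphi(e^{2\pi\mathbf i s})=\exp(s\,\mathrm{ad}\,\mathtt L)$ for all $s\in\mathbb R$, and $\varphi$ defines a Hodge structure of weight $0$ on the rational Lie algebra $\mathfrak g=\mathfrak g_{\mathbb Z}\otimes_{\mathbb Z}\mathbb Q$ (a homomorphism $S^1\to\mathrm{SL}(\mathfrak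 g_{\mathbb R})$ of real algebraic groups with $\varphi(-1)=1$) that is polarized by $-B$, where $B$ is the Killing form of $\mathfrak g$. Explicitly, with $Q=-B$ (symmetric, nondegenerate, extended $\mathbb C$-bilinearly), $\mathfrak g^{p,-p}=\{v\in\mathfrak g_{\mathbb C} : \varphi(z)v=z^{2p}v\ \text{for all } z\in S^1\}$ and $F^p=\bigoplus_{r\ge p}\mathfrak g^{r,-r}$, one has $Q(F^p,F^{1-p})=0$ for all $p\in\mathbb Z$ and $Q(v,\varphi(\mathbf i)\bar v)>0$ for all $0\ne v\in\mathfrak g_{\mathbb C}$. -/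

import Mathlib

open scoped TensorProduct

noncomputable section

/-- A complex Lie algebra is a real Lie algebra by restriction of scalars. -/
instance lieAlgebraComplexToReal (g : Type*) [LieRing g] [LieAlgebra ℂ g] :
    LieAlgebra ℝ g where
  lie_smul r x y := by
    rw [← Complex.coe_smul, ← Complex.coe_smul, lie_smul]

/-! ### Exponentials and the adjoint group -/

/-- `E = exp A`: the exponential series of the endomorphism `A` converges to `E` in the canonical
topology of the real vector space `End M` (its usual topology when `M` is finite dimensional). -/
def IsExp {M : Type*} [AddCommGroup M] [Module ℝ M] (A E : Module.End ℝ M) : Prop :=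
  letI : TopologicalSpace (Module.End ℝ M) := moduleTopology ℝ (Module.End ℝ M)
  HasSum (fun n : ℕ => ((n.factorial : ℝ)⁻¹) • A ^ n) E

/-- The (connected) adjoint group `G_ad` of a real Lie algebra: the group of automorphisms
generated by the `exp (ad x)`. -/
def adjointGroup (M : Type*) [LieRing M] [LieAlgebra ℝ M] : Subgroup (M ≃ₗ[ℝ] M) :=
  Subgroup.closure {e | ∃ x : M, IsExp (LieAlgebra.ad ℝ M x) (e : M →ₗ[ℝ] M)}

/-- The set `exp (ad t)`; for an abelian subalgebra `t` it is the connected subgroup of the adjoint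
group with Lie algebra (the image under `ad` of) `t`. -/
def expAd {M : Type*} [LieRing M] [LieAlgebra ℝ M] (t : LieSubalgebra ℝ M) :
    Set (Module.End ℝ M) :=
  {E | ∃ x ∈ t, IsExp (LieAlgebra.ad ℝ M x) E}

/-- The torus `exp (ad t)` is compact. -/
def IsCompactTorus {M : Type*} [LieRing M] [LieAlgebra ℝ M] (t : LieSubalgebra ℝ M) : Prop :=
  letI : TopologicalSpace (Module.End ℝ M) := moduleTopology ℝ (Module.End ℝ M)
  IsCompact (expAd t)

/-! ### Cartan decompositions, real forms and integral forms -/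

/-- A Cartan decomposition `M = k ⊕ q` of a real (semisimple) Lie algebra. -/
structure IsCartanDecomposition {M : Type*} [LieRing M] [LieAlgebra ℝ M]
    (k : LieSubalgebra ℝ M) (q : Submodule ℝ M) : Prop where
  isCompl : IsCompl k.toSubmodule q
  lie_k_q : ∀ x ∈ k, ∀ y ∈ q, ⁅x, y⁆ ∈ q
  lie_q_q : ∀ x ∈ q, ∀ y ∈ q, ⁅x, y⁆ ∈ k
  neg_def : ∀ x ∈ k, x ≠ 0 → killingForm ℝ M x x < 0
  pos_def : ∀ x ∈ q, x ≠ 0 → 0 < killingForm ℝ M x x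

/-- `gR` is a real form of the complex Lie algebra `g`: the natural map `ℂ ⊗ gR → g` is an
isomorphism. -/
def IsRealForm {g : Type*} [LieRing g] [LieAlgebra ℂ g] (gR : LieSubalgebra ℝ g) : Prop :=
  IsBaseChange ℂ gR.toSubmodule.subtype

/-- The complexification, inside `g`, of a real subspace of a real form `gR` of `g`. -/
def complexSpan {g : Type*} [LieRing g] [LieAlgebra ℂ g] {gR : LieSubalgebra ℝ g}
    (s : Submodule ℝ gR) : Submodule ℂ g :=
  Submodule.span ℂ ((fun x : gR => (x : g)) '' (s : Set gR))

/-- `MZ` is an integral form of the real Lie algebra `M`: a subgroup of `M`, finitely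
generated and closed under the bracket, such that the natural map `ℝ ⊗ MZ → M` is an isomorphism. -/
structure IsIntegralForm {M : Type*} [LieRing M] [LieAlgebra ℝ M]
    (MZ : LieSubalgebra ℤ M) : Prop where
  finite : Module.Finite ℤ MZ
  isBaseChange : IsBaseChange ℝ MZ.toSubmodule.subtype

/-- The canonical isomorphism `ℝ ⊗ (ℚ ⊗ MZ) ≃ M`, `r ⊗ (c ⊗ x) ↦ (r c) x`. -/
def IsIntegralForm.realEquiv {M : Type*} [LieRing M] [LieAlgebra ℝ M]
    {MZ : LieSubalgebra ℤ M} (h : IsIntegralForm MZ) :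
    (ℝ ⊗[ℚ] (ℚ ⊗[ℤ] MZ)) ≃ₗ[ℝ] M :=
  (TensorProduct.AlgebraTensorModule.cancelBaseChange ℤ ℚ ℝ ℝ MZ).trans h.isBaseChange.equiv

theorem IsIntegralForm.realEquiv_tmul {M : Type*} [LieRing M] [LieAlgebra ℝ M]
    {MZ : LieSubalgebra ℤ M} (h : IsIntegralForm MZ) (r : ℝ) (c : ℚ) (x : MZ) :
    h.realEquiv (r ⊗ₜ (c ⊗ₜ x)) = (r * c) • (x : M) := by
  simp [IsIntegralForm.realEquiv, IsBaseChange.equiv_tmul, Rat.smul_def, mul_comm]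

/-! ### Grading elements -/

section Grading

variable {g : Type*} [LieRing g] [LieAlgebra ℂ g] [FiniteDimensional ℂ g]

/-- The root lattice in the dual of a Cartan subalgebra. -/
def rootLattice (H : LieSubalgebra ℂ g) [H.IsCartanSubalgebra] :
    AddSubgroup (Module.Dual ℂ H) :=
  AddSubgroup.closure {f | ∃ α : LieModule.Weight ℂ H g, α.IsNonZero ∧ f = α.toLinear}

/-- An element `T` of the Cartan subalgebra is a grading element if it takes integral values on
the root lattice, i.e. it belongs to `Hom(Λ_rt, ℤ)`. -/
def IsGradingElement (H : LieSubalgebra ℂ g) [H.IsCartanSubalgebra] (T : H) : Prop :=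
  ∀ f ∈ rootLattice H, ∃ m : ℤ, f T = m

end Grading

/-- The graded piece `g_ℓ = {x | [T, x] = ℓ x}`. -/
def gradedPiece {g : Type*} [LieRing g] [LieAlgebra ℂ g] (T : g) (l : ℤ) : Submodule ℂ g :=
  Module.End.eigenspace (LieAlgebra.ad ℂ g T) (l : ℂ)

/-- The sum of the even-graded pieces. -/
def evenPart {g : Type*} [LieRing g] [LieAlgebra ℂ g] (T : g) : Submodule ℂ g :=
  ⨆ l : ℤ, gradedPiece T (2 * l)

/-- The sum of the odd-graded pieces. -/
def oddPart {g : Type*} [LieRing g] [LieAlgebra ℂ g] (T : g) : Submodule ℂ g :=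
  ⨆ l : ℤ, gradedPiece T (2 * l + 1)

/-! ### Polarized Hodge structures -/

/-- A Hodge structure of weight `n` on a rational vector space `V`: a homomorphism of real
algebraic groups from the circle to `SL(V_ℝ)` with `φ(-1) = (-1)^n`. -/
structure HodgeStructure (V : Type*) [AddCommGroup V] [Module ℚ V] (n : ℤ) where
  finite : Module.Finite ℚ V
  φ : Circle →* SpecialLinearGroup ℝ (ℝ ⊗[ℚ] V)
  /-- The matrix coefficients are polynomials in the real coordinates of the circle. -/
  algebraic : ∀ (v : ℝ ⊗[ℚ] V) (f : Module.Dual ℝ (ℝ ⊗[ℚ] V)), ∃ P : MvPolynomial (Fin 2) ℝ,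
    ∀ z : Circle, f (φ z v) = MvPolynomial.eval ![(z : ℂ).re, (z : ℂ).im] P
  weight : ∀ z : Circle, (z : ℂ) = -1 → ∀ v : ℝ ⊗[ℚ] V, φ z v = ((-1 : ℝ) ^ n) • v

namespace HodgeStructure

variable {V : Type*} [AddCommGroup V] [Module ℚ V] {n : ℤ}

/-- The complex linear extension of `φ(z)` to `V_ℂ`. -/
def φC (h : HodgeStructure V n) (z : Circle) :
    (ℂ ⊗[ℝ] (ℝ ⊗[ℚ] V)) →ₗ[ℂ] (ℂ ⊗[ℝ] (ℝ ⊗[ℚ] V)) :=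
  LinearMap.baseChange ℂ ((h.φ z : (ℝ ⊗[ℚ] V) ≃ₗ[ℝ] (ℝ ⊗[ℚ] V)) : (ℝ ⊗[ℚ] V) →ₗ[ℝ] (ℝ ⊗[ℚ] V))

/-- `V^{p,q} = {v | φ(z) v = z^(p-q) v for all z}`. -/
def piece (h : HodgeStructure V n) (p q : ℤ) : Submodule ℂ (ℂ ⊗[ℝ] (ℝ ⊗[ℚ] V)) :=
  ⨅ z : Circle, Module.End.eigenspace (h.φC z) ((z : ℂ) ^ (p - q))

/-- The Hodge filtration `F^p = ⨁_{r ≥ p} V^{r,n-r}`. -/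
def filtration (h : HodgeStructure V n) (p : ℤ) : Submodule ℂ (ℂ ⊗[ℝ] (ℝ ⊗[ℚ] V)) :=
  ⨆ r : ℤ, ⨆ _ : p ≤ r, h.piece r (n - r)

variable (V) in
/-- Complex conjugation on `V_ℂ = ℂ ⊗ V_ℝ`. -/
def conjC : (ℂ ⊗[ℝ] (ℝ ⊗[ℚ] V)) →ₗ[ℝ] (ℂ ⊗[ℝ] (ℝ ⊗[ℚ] V)) :=
  LinearMap.rTensor (ℝ ⊗[ℚ] V) Complex.conjAe.toLinearMap

/-- The complex bilinear extension of a rational bilinear form to `V_ℂ`. -/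
def formC (Q : LinearMap.BilinForm ℚ V) : LinearMap.BilinForm ℂ (ℂ ⊗[ℝ] (ℝ ⊗[ℚ] V)) :=
  LinearMap.BilinForm.baseChange ℂ (LinearMap.BilinForm.baseChange ℝ Q)

/-- The Hodge structure is polarized by `Q`. -/
structure IsPolarizedBy (h : HodgeStructure V n) (Q : LinearMap.BilinForm ℚ V) : Prop where
  nondegenerate : Q.Nondegenerate
  parity : ∀ u v : V, Q u v = (-1 : ℚ) ^ n * Q v u
  /-- `Q(F^p, F^(n-p+1)) = 0`. -/
  relation₁ : ∀ p : ℤ, ∀ u ∈ h.filtration p, ∀ v ∈ h.filtration (n - p + 1), formC Q u v = 0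
  /-- `Q(v, φ(i) v̄)` is real and positive for `v ≠ 0`. -/
  relation₂ : ∀ z : Circle, (z : ℂ) = Complex.I → ∀ v : ℂ ⊗[ℝ] (ℝ ⊗[ℚ] V), v ≠ 0 →
    (formC Q v (h.φC z (conjC V v))).im = 0 ∧ 0 < (formC Q v (h.φC z (conjC V v))).re

end HodgeStructure

end

/-! Let ψ act on `g_ℓ` by `(-1)^ℓ`. Suppose τ is a conjugation (antilinear involutive automorphism)
that commutes with ψ and is compact: the Hermitian form `κ(x, τx)` is negative definite, κ being the
Killing form. Then `σ = τψ` is again a conjugation, and ψ is a Cartan involution of its real form: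
for `σx = x` and `ψx = ±x` one has `κ(x, x) = ±κ(x, τx)`, which is negative on the even part and
positive on the odd part. So everything reduces to finding a τ that is compatible with `T` and with
an integral structure.

Take `τ = conj ∘ θ`, where θ is a Chevalley involution (`-1` on the Cartan subalgebra `H`) and
`conj` conjugates coordinates in a Chevalley basis adapted to θ. The involution is obtained in
`Basis.exists_involution` as the subalgebra of `L × L` generated by the pairs `(e i, f i)` and `(f
i, e i)`, which turns out to be a graph. That `conj` respects brackets rests on the integrality of
the structure constants: by `exists_int_lie_eq_smul`, `[e α, e β] = ±(p + 1) e (α + β)`, where p is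
the length of the lower part of the α-string through β. Compactness of τ is
`exists_killingForm_conj_involution`; it comes from `κ(h, conj h) = ∑ |α(h)|²` on `H` and from `κ(e
α, e (-α)) > 0`.

The circle acts on `g_ℓ` by `z^(2ℓ)`, which integrates `4πi T`. Since θ negates degrees and
conjugation inverts unit scalars, this action commutes with σ. At `z = i` it is ψ, so `φ(i)σ = τ`,
and the second bilinear relation for `-κ` is once more the compactness of τ. The first relation
follows from invariance of κ under the circle. The integral form consists of the σ-fixed points in
the Gaussian integer span of the Chevalley basis. The roots are purely imaginary on the fixed part
of `H`, so its torus is a continuous image of a product of circles. -/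

noncomputable section
open LieAlgebra LieAlgebra.IsKilling LieModule Module Set

/-! ### Root strings and root lengths -/

namespace LieAlgebra.IsKilling

variable {K L : Type*} [Field K] [CharZero K] [LieRing L] [LieAlgebra K L] [FiniteDimensional K L]
  [IsKilling K L] {H : LieSubalgebra K L} [H.IsCartanSubalgebra] [IsTriangularizable K H L]

lemma exists_smul_eq_of_mem_rootSpace {β : Weight K H L} (hβ : β.IsNonZero) {u v : L}
    (hu : u ∈ rootSpace H β) (hu₀ : u ≠ 0) (hv : v ∈ rootSpace H β) : ∃ c : K, c • u = v := by
  obtain ⟨c, hc⟩ := (finrank_eq_one_iff_of_nonzero' (⟨u, hu⟩ : rootSpace H β)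
    (by simpa using hu₀)).mp (finrank_rootSpace_eq_one β hβ) ⟨v, hv⟩
  exact ⟨c, congrArg Subtype.val hc⟩

/-- The action of `f e` on a root space, for an `sl₂`-triple `(h, e, f)` attached to a root. -/
lemma lie_lie_eq_smul_of_isSl2Triple {α β : Weight K H L} (hα : α.IsNonZero) (hβ : β.IsNonZero)
    {h e f v : L} (t : IsSl2Triple h e f) (he : e ∈ rootSpace H α) (hf : f ∈ rootSpace H (-α))
    (hv : v ∈ rootSpace H β) :
    ⁅f, ⁅e, v⁆⁆ = ((chainTopCoeff α β : K) * (chainBotCoeff α β + 1)) • v := by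
  obtain rfl := t.h_eq_coroot hα he hf
  set p := chainBotCoeff α β
  set q := chainTopCoeff α β
  obtain ⟨m, hm, hm₀⟩ := (chainBot α β).exists_ne_zero
  have hbot : chainBot α β (coroot α) = -((p + q : ℕ) : K) := by
    rw [coe_chainBot]
    simp only [Pi.add_apply, Pi.smul_apply, root_apply_coroot hα, apply_coroot_eq_cast α β]
    push_cast
    simp only [p, q, zsmul_eq_mul]
    push_cast
    ring
  -- A vector m at the bottom of the α-string is killed by `f`, hence is primitive of weight `p + q`
  -- for the reversed triple `(-h, f, e)`. Since `v` is a multiple of `e^p m`, the standard `sl₂`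
  -- formula yields the factor `(p + 1)((p + q) - p)`.
  have hprim : t.symm.HasPrimitiveVectorWith m ((p + q : ℕ) : K) := by
    refine ⟨hm₀, ?_, ?_⟩
    · rw [neg_lie]
      have := lie_eq_smul_of_mem_rootSpace hm (coroot α)
      rw [LieSubalgebra.coe_bracket_of_module] at this
      rw [this, hbot, neg_smul, neg_neg]
    · have := lie_mem_genWeightSpace_of_mem_genWeightSpace hf hm
      rwa [genWeightSpace_neg_add_chainBot _ _ (by simpa using! hα), LieSubmodule.mem_bot] at this
  have hmem : (toEnd K L L e ^ p) m ∈ rootSpace H β := by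
    have := toEnd_pow_apply_mem he hm p
    rwa [coe_chainBot, ← natCast_zsmul, ← add_assoc, ← add_smul, add_neg_cancel, zero_smul,
      zero_add] at this
  obtain ⟨c, rfl⟩ := exists_smul_eq_of_mem_rootSpace hβ hmem
    (hprim.pow_toEnd_f_ne_zero_of_eq_nat rfl (Nat.le_add_right p q)) hv
  rw [lie_smul, lie_smul, hprim.lie_f_pow_toEnd_f, hprim.lie_e_pow_succ_toEnd_f, smul_comm c]
  congr 1
  push_cast
  ring

lemma one_le_chainTopCoeff_of_rootSpace_ne_bot {α β : Weight K H L} (hα : α.IsNonZero)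
    (h : rootSpace H (α + β : H → K) ≠ ⊥) : 1 ≤ chainTopCoeff α β := by
  have := (rootSpace_zsmul_add_ne_bot_iff α β hα 1).mp (by simpa using h)
  lia

/-- Applying `f` to the bracket returns `q(p + 1) v`, and `q ≥ 1` because the string continues above
β. -/
lemma lie_ne_zero_of_rootSpace_add_ne_bot {α β : Weight K H L} (hα : α.IsNonZero)
    (hβ : β.IsNonZero) (h : rootSpace H (α + β : H → K) ≠ ⊥) {u v : L}
    (hu : u ∈ rootSpace H α) (hu₀ : u ≠ 0) (hv : v ∈ rootSpace H β) (hv₀ : v ≠ 0) :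
    ⁅u, v⁆ ≠ 0 := by
  obtain ⟨h, e, f, t, he, hf⟩ := exists_isSl2Triple_of_weight_isNonZero hα
  obtain ⟨c, rfl⟩ := exists_smul_eq_of_mem_rootSpace hα hu hu₀ he
  intro h0
  have := lie_lie_eq_smul_of_isSl2Triple hα hβ t he hf hv
  rw [smul_lie, h0, smul_zero, lie_zero, eq_comm, smul_eq_zero_iff_left hv₀] at this
  have h1 := one_le_chainTopCoeff_of_rootSpace_ne_bot hα ‹_›
  rcases mul_eq_zero.mp this with h2 | h2
  · rw [Nat.cast_eq_zero] at h2; lia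
  · exact Nat.cast_add_one_ne_zero _ h2

/-- The squared length of a root for the form on the dual of the Cartan subalgebra induced by the
Killing form. -/
def rootLengthSq (α : Weight K H L) : K := α ((cartanEquivDual H).symm α)

lemma rootLengthSq_ne_zero {α : Weight K H L} (hα : α.IsNonZero) : rootLengthSq α ≠ 0 :=
  root_apply_cartanEquivDual_symm_ne_zero hα

lemma apply_coroot_mul_rootLengthSq {α : Weight K H L} (hα : α.IsNonZero) (β : Weight K H L) :
    β (coroot α) * rootLengthSq α = 2 * β ((cartanEquivDual H).symm α) := by
  have h := rootLengthSq_ne_zero hα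
  have : Weight.toLinear K H L β (coroot α) =
      2 * ((rootLengthSq α)⁻¹ * β ((cartanEquivDual H).symm α)) := by
    rw [coroot, map_nsmul, map_smul]
    simp [rootLengthSq]
  rw [Weight.toLinear_apply] at this
  rw [this]
  field_simp

omit [IsTriangularizable K H L] in
lemma apply_cartanEquivDual_symm_comm (α β : Weight K H L) :
    β ((cartanEquivDual H).symm α) = α ((cartanEquivDual H).symm β) := by
  have h (γ : Weight K H L) (x : H) :
      γ x = traceForm K H L ((cartanEquivDual H).symm γ) x := by
    conv_lhs => rw [← Weight.toLinear_apply, ← (cartanEquivDual H).apply_symm_apply γ.toLinear]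
    rfl
  rw [h β, h α, LieModule.traceForm_comm]

lemma apply_coroot_apply_coroot_mem (α β : Weight K H L) (hα : α.IsNonZero) (hβ : β.IsNonZero) :
    ∃ n m : ℤ, α (coroot β) = n ∧ β (coroot α) = m ∧ (n, m) ∈
      ({(0, 0), (1, 1), (-1, -1), (1, 2), (2, 1), (-1, -2), (-2, -1), (1, 3), (3, 1), (-1, -3),
        (-3, -1), (2, 2), (-2, -2)} : Set (ℤ × ℤ)) := by
  let i : H.root := ⟨α, by simpa using hα⟩
  let j : H.root := ⟨β, by simpa using hβ⟩
  refine ⟨_, _, ?_, ?_,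
    (rootSystem H).pairingIn_pairingIn_mem_set_of_isCrystal_of_isRed i j⟩
  · exact ((rootSystem H).algebraMap_pairingIn ℤ i j).symm
  · exact ((rootSystem H).algebraMap_pairingIn ℤ j i).symm

/-- This is the ratio of squared lengths that makes the structure constants perfect squares up to
sign. There are only finitely many rank-two configurations: the string through β has `p + q ≤ 3`,
and in each case the crystallographic pairings fix the length ratios. -/
lemma chainTopCoeff_mul_rootLengthSq {α β γ : Weight K H L} (hα : α.IsNonZero) (hβ : β.IsNonZero)
    (hγ : γ.IsNonZero) (h : (γ : H → K) = α + β) :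
    (chainTopCoeff α β : K) * rootLengthSq γ = (chainBotCoeff α β + 1) * rootLengthSq β := by
  have hq := one_le_chainTopCoeff_of_rootSpace_ne_bot hα (h ▸ γ.genWeightSpace_ne_bot)
  have hδ : (chainTop α β).IsNonZero := chainTop_isNonZero α β hα
  obtain ⟨k, k', hk, -, hkk⟩ := apply_coroot_apply_coroot_mem (chainTop α β) α hδ hα
  obtain ⟨n, m, hn, hm, hnm⟩ := apply_coroot_apply_coroot_mem β α hβ hα
  obtain ⟨n', m', hn', hm', hnm'⟩ := apply_coroot_apply_coroot_mem γ α hγ hα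
  have hx := rootLengthSq_ne_zero hα
  have hy := rootLengthSq_ne_zero hβ
  have hz := rootLengthSq_ne_zero hγ
  have e1 := apply_coroot_mul_rootLengthSq hα β
  have e2 := apply_coroot_mul_rootLengthSq hβ α
  have e3 := apply_coroot_mul_rootLengthSq hα γ
  have e4 := apply_coroot_mul_rootLengthSq hγ α
  rw [apply_cartanEquivDual_symm_comm] at e2 e4
  have hγs : (cartanEquivDual H).symm γ.toLinear =
      (cartanEquivDual H).symm α.toLinear + (cartanEquivDual H).symm β.toLinear := by
    rw [← map_add]
    congr 1
    ext x
    simp [h]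
  have e5 : rootLengthSq γ = rootLengthSq α + 2 * β ((cartanEquivDual H).symm α) +
      rootLengthSq β := by
    have hadd (δ : Weight K H L) (x y : H) : δ (x + y) = δ x + δ y := δ.toLinear.map_add x y
    rw [rootLengthSq, hγs, h, Pi.add_apply, hadd, hadd, apply_cartanEquivDual_symm_comm β α]
    simp only [rootLengthSq]
    ring
  have e6 : γ ((cartanEquivDual H).symm α) = rootLengthSq α + β ((cartanEquivDual H).symm α) := by
    rw [h]; rfl
  have hpq : (n : K) = (chainBotCoeff α β - chainTopCoeff α β : ℤ) := by
    rw [← hn, apply_coroot_eq_cast α β]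
  have hkq : (k : K) = (chainBotCoeff α β + chainTopCoeff α β : ℤ) := by
    rw [← hk, coe_chainTop, Pi.add_apply, Pi.smul_apply, root_apply_coroot hα, hn, hpq,
      zsmul_eq_mul]
    push_cast
    ring
  have hn2 : (n' : K) = (n + 2 : ℤ) := by
    rw [← hn', h, Pi.add_apply, root_apply_coroot hα, hn]
    push_cast
    ring
  rw [Int.cast_inj] at hpq hkq hn2
  rw [hn] at e1
  rw [hm] at e2
  rw [hn'] at e3
  rw [hm'] at e4
  generalize β ((cartanEquivDual H).symm α) = w at *
  generalize rootLengthSq α = x at *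
  generalize rootLengthSq β = y at *
  generalize rootLengthSq γ = z at *
  generalize chainBotCoeff α β = p at *
  generalize chainTopCoeff α β = q at *
  -- The pairing of the top of the string with α equals `p + q`, and the list of admissible pairings
  -- stops at 3.
  have hk3 : k ≤ 3 := by
    simp only [mem_insert_iff, mem_singleton_iff, Prod.mk.injEq] at hkk
    omega
  rw [e6] at e3 e4
  simp only [mem_insert_iff, mem_singleton_iff, Prod.mk.injEq] at hnm hnm'
  clear hkk
  have : (n = -1 ∧ q = p + 1) ∨ (n = 0 ∧ p = 1 ∧ q = 1) ∨ (n = -2 ∧ p = 0 ∧ q = 2) ∨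
    (n = 1 ∧ p = 2 ∧ q = 1) ∨ (n = -3 ∧ p = 0 ∧ q = 3) := by omega
  rcases this with ⟨rfl, rfl⟩ | ⟨rfl, rfl, rfl⟩ | ⟨rfl, rfl, rfl⟩ | ⟨rfl, rfl, rfl⟩ |
    ⟨rfl, rfl, rfl⟩
  · push_cast at *
    rw [e5]
    linear_combination (-(p:K) - 1) * e1
  -- The pair `(2, 2)` would mean equal roots; here it forces a root of length zero. The pair `(-2,
  -- -2)` in the next case is excluded in the same way.
  · obtain rfl | rfl : m' = 1 ∨ m' = 2 := by omega
    · push_cast at *; grind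
    · push_cast at *; grind
  · obtain rfl | rfl : m = -1 ∨ m = -2 := by omega
    · push_cast at *; grind
    · push_cast at *; grind
  · obtain rfl : m' = 1 := by omega
    push_cast at *; grind
  · obtain rfl : m = -1 := by omega
    push_cast at *; grind

end LieAlgebra.IsKilling

end

/-! ### The Chevalley involution as a graph in `L × L` -/

noncomputable section
open LieAlgebra LieAlgebra.IsKilling LieModule Module Set

namespace LieAlgebra.Basis

open LieSubalgebra

section Graph

variable {ι K L : Type*} [Finite ι] [Field K] [LieRing L] [LieAlgebra K L]
  {H : LieSubalgebra K L} (b : Basis ι H)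

/-- The subalgebra of `L × L` generated by the pairs `(e i, f i)` and `(f i, e i)`. -/
def involutionGraph : LieSubalgebra K (L × L) :=
  lieSpan K (L × L) (range (fun i ↦ (b.e i, b.f i)) ∪ range (fun i ↦ (b.f i, b.e i)))

def graphE (i : ι) : b.involutionGraph := ⟨(b.e i, b.f i), subset_lieSpan <| .inl ⟨i, rfl⟩⟩

def graphF (i : ι) : b.involutionGraph := ⟨(b.f i, b.e i), subset_lieSpan <| .inr ⟨i, rfl⟩⟩

def graphH (i : ι) : b.involutionGraph := ⁅b.graphE i, b.graphF i⁆

@[simp] lemma coe_graphE (i : ι) : (b.graphE i : L × L) = (b.e i, b.f i) := rfl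

@[simp] lemma coe_graphF (i : ι) : (b.graphF i : L × L) = (b.f i, b.e i) := rfl

@[simp] lemma coe_graphH (i : ι) : (b.graphH i : L × L) = (b.h i, -b.h i) := by
  simp only [graphH, LieSubalgebra.coe_bracket, coe_graphE, coe_graphF, Prod.bracket_apply,
    (b.sl2 i).lie_e_f, (b.sl2 i).symm.lie_e_f]

/-- The subalgebra `involutionGraph` inherits a basis. -/
def involutionGraphBasis : Basis ι (lieSpan K b.involutionGraph (range b.graphH)) where
  A := b.A
  h := b.graphH
  e := b.graphE
  f := b.graphF
  cartan_eq_lieSpan := rfl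
  span_ef := by
    have h : range b.graphE ∪ range b.graphF = Subtype.val ⁻¹'
        (range (fun i ↦ (b.e i, b.f i)) ∪ range (fun i ↦ (b.f i, b.e i))) := by
      ext x
      simp [Subtype.ext_iff]
    rw [h]
    exact lieSpan_lieSpan_coe_preimage
  linInd := by
    refine .of_comp (LinearMap.fst K L L ∘ₗ b.involutionGraph.toSubmodule.subtype) ?_
    convert b.linInd using 1
    ext i
    exact congrArg Prod.fst (b.coe_graphH i)
  nondegen := b.nondegen
  sl2 i :=
    { h_ne_zero := by simp [Subtype.ext_iff, (b.sl2 i).h_ne_zero]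
      lie_e_f := rfl
      lie_h_e_nsmul := by
        simp [Subtype.ext_iff, (b.sl2 i).lie_h_e_nsmul, (b.sl2 i).lie_h_f_nsmul]
      lie_h_f_nsmul := by
        simp [Subtype.ext_iff, (b.sl2 i).lie_h_e_nsmul, (b.sl2 i).lie_h_f_nsmul] }
  lie_h_h i j := by simp [Subtype.ext_iff, b.lie_h_h]
  lie_h_e i j := by simp [Subtype.ext_iff, b.lie_h_e, b.lie_h_f]
  lie_h_f i j := by simp [Subtype.ext_iff, b.lie_h_e, b.lie_h_f]
  lie_e_f_ne i j hij := by
    have : ⁅b.f i, b.e j⁆ = 0 := by rw [← lie_skew, b.lie_e_f_ne j i hij.symm, neg_zero]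
    simp [Subtype.ext_iff, b.lie_e_f_ne i j hij, this]

lemma surjective_snd_involutionGraph (y : L) : ∃ x, (x, y) ∈ b.involutionGraph := by
  have hy : y ∈ lieSpan K L (range b.e ∪ range b.f) := by simp [b.span_ef]
  induction hy using lieSpan_induction with
  | mem u hu =>
    rcases hu with ⟨i, rfl⟩ | ⟨i, rfl⟩
    · exact ⟨_, (b.graphF i).2⟩
    · exact ⟨_, (b.graphE i).2⟩
  | zero => exact ⟨0, zero_mem _⟩
  | add u v _ _ hu hv =>
    obtain ⟨x, hx⟩ := hu
    obtain ⟨x', hx'⟩ := hv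
    exact ⟨x + x', add_mem hx hx'⟩
  | smul t u _ hu =>
    obtain ⟨x, hx⟩ := hu
    exact ⟨t • x, b.involutionGraph.smul_mem t hx⟩
  | lie u v _ _ hu hv =>
    obtain ⟨x, hx⟩ := hu
    obtain ⟨x', hx'⟩ := hv
    exact ⟨⁅x, x'⁆, b.involutionGraph.lie_mem hx hx'⟩

lemma swap_mem_involutionGraph {z : L × L} (hz : z ∈ b.involutionGraph) :
    z.swap ∈ b.involutionGraph := by
  induction hz using lieSpan_induction with
  | mem u hu =>
    rcases hu with ⟨i, rfl⟩ | ⟨i, rfl⟩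
    · exact (b.graphF i).2
    · exact (b.graphE i).2
  | zero => exact zero_mem _
  | add u v _ _ hu hv => exact add_mem hu hv
  | smul t u _ hu => exact b.involutionGraph.smul_mem t hu
  | lie u v _ _ hu hv => exact b.involutionGraph.lie_mem hu hv

lemma fst_eq_neg_snd_of_mem_lieSpan_graphH {z : b.involutionGraph}
    (hz : z ∈ lieSpan K b.involutionGraph (range b.graphH)) :
    (z : L × L).1 = -(z : L × L).2 := by
  rw [← LieSubalgebra.mem_toSubmodule, b.involutionGraphBasis.coe_cartan_eq_span] at hz
  induction hz using Submodule.span_induction with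
  | mem u hu => obtain ⟨i, rfl⟩ := hu; simp [involutionGraphBasis]
  | zero => simp
  | add u v _ _ hu hv => simp [hu, hv, add_comm]
  | smul t u _ hu => simp [hu]

/-- The element `(0, y)` commutes with all `(h i, -h i)`, so it lies in the zero root space of the
Cartan subalgebra they span, that is, in this subalgebra itself. Its elements have opposite
components. -/
lemma eq_zero_of_mem_cartan_of_mem_involutionGraph [CharZero K] [FiniteDimensional K L] {y : L} (hy : y ∈ H)
    (hD : ((0 : L), y) ∈ b.involutionGraph) : y = 0 := by
  have := Fintype.ofFinite ι
  have := b.involutionGraphBasis.isCartanSubalgebra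
  have := b.isLieAbelian_cartan
  have hH (i : ι) : ⁅b.h i, y⁆ = 0 := by
    have := congrArg Subtype.val (trivial_lie_zero H H (b.h' i) ⟨y, hy⟩)
    simpa [h'] using this
  have hmem : (⟨(0, y), hD⟩ : b.involutionGraph) ∈
      lieSpan K b.involutionGraph (range b.graphH) := by
    rw [← LieSubalgebra.mem_toLieSubmodule, ← rootSpace_zero_eq, LieModule.mem_genWeightSpace]
    rintro ⟨z, hz⟩
    refine ⟨1, ?_⟩
    rw [← LieSubalgebra.mem_toSubmodule, b.involutionGraphBasis.coe_cartan_eq_span] at hz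
    simp only [Pi.zero_apply, zero_smul, sub_zero, pow_one, toEnd_apply_apply]
    change ⁅z, _⁆ = _
    clear * - hz hH
    induction hz using Submodule.span_induction with
    | mem u hu =>
      obtain ⟨i, rfl⟩ := hu
      simp [involutionGraphBasis, Subtype.ext_iff, hH]
    | zero => simp
    | add u v _ _ hu hv => rw [add_lie, hu, hv, add_zero]
    | smul t u _ hu => rw [smul_lie, hu, smul_zero]
  have := b.fst_eq_neg_snd_of_mem_lieSpan_graphH hmem
  simpa using this.symm

end Graph

section Involution

variable {ι K L : Type*} [Finite ι] [Field K] [CharZero K] [LieRing L] [LieAlgebra K L]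
  [FiniteDimensional K L] [IsKilling K L] {H : LieSubalgebra K L} [H.IsCartanSubalgebra]
  [IsTriangularizable K H L] (b : Basis ι H)

/-- Because the second projection is onto, these `y` form an ideal. It meets `H` trivially, so it
contains no coroot and hence no root space; the root decomposition of an ideal then places it inside
`H`. -/
lemma eq_zero_of_mem_involutionGraph {y : L} (hD : ((0 : L), y) ∈ b.involutionGraph) : y = 0 := by
  let I : LieIdeal K L :=
    { carrier := {y | ((0 : L), y) ∈ b.involutionGraph}
      add_mem' := fun {u v} hu hv ↦ by
        simpa using b.involutionGraph.add_mem hu hv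
      zero_mem' := b.involutionGraph.zero_mem
      smul_mem' := fun t u hu ↦ by
        simpa using b.involutionGraph.smul_mem t hu
      lie_mem := fun {u v} hv ↦ by
        obtain ⟨x, hx⟩ := b.surjective_snd_involutionGraph u
        simpa using b.involutionGraph.lie_mem hx hv }
  have hI : ∀ y ∈ H, y ∈ I → y = 0 := fun y hy hyI ↦
    b.eq_zero_of_mem_cartan_of_mem_involutionGraph hy hyI
  have hα (α : H.root) : ¬ rootSpace H α.1 ≤ I.restr H := fun h ↦ by
    have h1 : (coroot α.1 : L) ∈ I.restr H :=
      LieIdeal.corootSubmodule_le I h (coe_coroot_mem_corootSubmodule α.1)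
    have h2 := hI _ (coroot α.1).2 h1
    rw [ZeroMemClass.coe_eq_zero, coroot_eq_zero_iff] at h2
    exact H.isNonZero_coe_root α h2
  have hle : I.restr H ≤ H.toLieSubmodule := by
    rw [lieIdeal_eq_inf_cartan_sup_biSup_rootSpace I]
    exact sup_le inf_le_right (iSup₂_le fun α h ↦ (hα α h).elim)
  exact hI y (hle (show y ∈ I.restr H from hD)) hD

/-- The Chevalley involution attached to a basis. -/
lemma exists_involution (b : Basis ι H) :
    ∃ θ : L →ₗ⁅K⁆ L, (∀ x, θ (θ x) = x) ∧ ∀ h ∈ H, θ h = -h := by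
  let p : b.involutionGraph →ₗ⁅K⁆ L := (LieHom.fst K L L).comp b.involutionGraph.incl
  -- Bijectivity of the first projection says that the subalgebra is the graph of a homomorphism.
  -- Its symmetry under swapping makes that homomorphism an involution.
  have hp : Function.Bijective p := by
    refine ⟨(injective_iff_map_eq_zero p).mpr ?_, fun x ↦ ?_⟩
    · rintro ⟨⟨x, y⟩, h⟩ (rfl : x = 0)
      obtain rfl := b.eq_zero_of_mem_involutionGraph h
      rfl
    · obtain ⟨y, hy⟩ := b.surjective_snd_involutionGraph x
      exact ⟨⟨_, b.swap_mem_involutionGraph hy⟩, rfl⟩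
  let e : b.involutionGraph ≃ₗ⁅K⁆ L := LieEquiv.ofBijective p hp
  let θ : L →ₗ⁅K⁆ L := ((LieHom.snd K L L).comp b.involutionGraph.incl).comp e.symm.toLieHom
  have hθ {x y : L} (h : (x, y) ∈ b.involutionGraph) : θ x = y := by
    have : e.symm x = ⟨(x, y), h⟩ := hp.1 (e.apply_symm_apply x)
    change ((e.symm x : b.involutionGraph) : L × L).2 = y
    rw [this]
  have hθ' (x : L) : (x, θ x) ∈ b.involutionGraph := by
    obtain ⟨y, hy⟩ := b.surjective_snd_involutionGraph x
    have := b.swap_mem_involutionGraph hy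
    rwa [hθ this]
  refine ⟨θ, fun x ↦ hθ (b.swap_mem_involutionGraph (hθ' x)), fun h hh ↦ ?_⟩
  rw [← LieSubalgebra.mem_toSubmodule, b.coe_cartan_eq_span] at hh
  induction hh using Submodule.span_induction with
  | mem u hu =>
    obtain ⟨i, rfl⟩ := hu
    have := (b.graphH i).2
    rw [coe_graphH] at this
    exact hθ this
  | zero => simp
  | add u v _ _ hu hv => simp [hu, hv, add_comm]
  | smul t u _ hu => simp [hu]

end Involution

end LieAlgebra.Basis

/-! ### Generation by simple root spaces -/

namespace LieAlgebra.IsKilling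

variable {K L : Type*} [Field K] [CharZero K] [LieRing L] [LieAlgebra K L] [FiniteDimensional K L]
  [IsKilling K L] {H : LieSubalgebra K L} [H.IsCartanSubalgebra] [IsTriangularizable K H L]

lemma rootSpace_le_of_mem_of_lie_mem {S : LieSubalgebra K L} {α β γ : Weight K H L}
    (hα : α.IsNonZero) (hβ : β.IsNonZero) (hγ : γ.IsNonZero) (h : (γ : H → K) = α + β)
    (hαS : (rootSpace H α).toSubmodule ≤ S.toSubmodule)
    (hβS : (rootSpace H β).toSubmodule ≤ S.toSubmodule) :
    (rootSpace H γ).toSubmodule ≤ S.toSubmodule := by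
  obtain ⟨u, hu, hu₀⟩ := α.exists_ne_zero
  obtain ⟨v, hv, hv₀⟩ := β.exists_ne_zero
  have huv := lie_mem_genWeightSpace_of_mem_genWeightSpace hu hv
  rw [← h] at huv
  intro w hw
  obtain ⟨c, rfl⟩ := exists_smul_eq_of_mem_rootSpace hγ huv
    (lie_ne_zero_of_rootSpace_add_ne_bot hα hβ (h ▸ γ.genWeightSpace_ne_bot) hu hu₀ hv hv₀) hw
  exact S.smul_mem c (S.lie_mem (hαS hu) (hβS hv))

/-- Every root is reached from simple roots by adding simple roots and negating, and brackets of
root spaces fill the root space of the sum. Carrying α and `-α` through the induction together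
handles negation; the coroots then arise as brackets of opposite root vectors. -/
lemma eq_top_of_rootSpace_le {S : LieSubalgebra K L} (b : (rootSystem H).Base)
    (h : ∀ i ∈ b.support, (rootSpace H i.1).toSubmodule ≤ S.toSubmodule ∧
      (rootSpace H (-i.1 : Weight K H L)).toSubmodule ≤ S.toSubmodule) : S = ⊤ := by
  have key (i : H.root) : (rootSpace H i.1).toSubmodule ≤ S.toSubmodule ∧
      (rootSpace H (-i.1 : Weight K H L)).toSubmodule ≤ S.toSubmodule := by
    induction i using b.induction_add with
    | h₀ i hi =>
      have : ((rootSystem H).reflectionPerm i i).1 = -i.1 := by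
        apply Weight.ext
        intro x
        have := LinearMap.congr_fun ((rootSystem H).root_reflectionPerm i i) x
        rw [RootPairing.reflection_apply_self] at this
        exact this
      rw [this, neg_neg]
      exact hi.symm
    | h₁ i hi => exact h i hi
    | h₂ i j k hk hi hj =>
      have hk' : (k.1 : H → K) = i.1 + j.1 := by
        ext x
        simpa using LinearMap.congr_fun hk x
      refine ⟨rootSpace_le_of_mem_of_lie_mem (H.isNonZero_coe_root i) (H.isNonZero_coe_root j)
        (H.isNonZero_coe_root k) hk' hi.1 (h j hj).1,
        rootSpace_le_of_mem_of_lie_mem (H.isNonZero_coe_root i).neg (H.isNonZero_coe_root j).neg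
        (H.isNonZero_coe_root k).neg ?_ hi.2 (h j hj).2⟩
      simp only [Weight.coe_neg, hk', neg_add]
  have hco (α : Weight K H L) (hα : α.IsNonZero) : (coroot α : L) ∈ S := by
    obtain ⟨h, e, f, t, he, hf⟩ := exists_isSl2Triple_of_weight_isNonZero hα
    obtain rfl := t.h_eq_coroot hα he hf
    rw [← t.lie_e_f]
    exact S.lie_mem ((key ⟨α, by simpa using hα⟩).1 he) ((key ⟨α, by simpa using hα⟩).2 hf)
  have hH : H.toSubmodule ≤ S.toSubmodule := by
    intro x hx
    have hx' : (⟨x, hx⟩ : H) ∈ Submodule.span K (range (rootSystem H).coroot) := by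
      rw [RootPairing.IsRootSystem.span_coroot_eq_top]
      trivial
    have := Submodule.mem_map_of_mem (f := H.toSubmodule.subtype) hx'
    rw [Submodule.map_span] at this
    refine Submodule.span_le.mpr ?_ this
    rintro _ ⟨_, ⟨α, rfl⟩, rfl⟩
    exact hco α.1 (H.isNonZero_coe_root α)
  rw [eq_top_iff]
  intro x _
  have hx : x ∈ (⨆ χ : Weight K H L, genWeightSpace L χ).toSubmodule := by
    rw [iSup_genWeightSpace_eq_top' K H L]
    trivial
  rw [LieSubmodule.iSup_toSubmodule] at hx
  refine (iSup_le fun χ ↦ ?_ : _ ≤ S.toSubmodule) hx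
  by_cases hχ : χ.IsZero
  · rw [hχ, show genWeightSpace L (0 : H → K) = rootSpace H 0 from rfl, rootSpace_zero_eq]
    exact hH
  · exact (key ⟨χ, by simpa using hχ⟩).1

/-- A base of the root system extends to a `LieAlgebra.Basis`. -/
lemma nonempty_basis (b : (rootSystem H).Base) : Nonempty (LieAlgebra.Basis b.support H) := by
  have hb (i : b.support) : i.1.1.IsNonZero := H.isNonZero_coe_root i.1
  choose h e f t he hf using fun i : b.support ↦ exists_isSl2Triple_of_weight_isNonZero (hb i)
  have hh (i : b.support) : h i = coroot i.1.1 := (t i).h_eq_coroot (hb i) (he i) (hf i)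
  have hlin : LinearIndependent K fun i : b.support ↦ coroot i.1.1 := b.linearIndepOn_coroot
  have hspan : H.toSubmodule = Submodule.span K (range h) := by
    have h1 := congrArg (Submodule.map H.toSubmodule.subtype) b.span_coroot_support
    have h2 : (rootSystem H).corootSpan K = ⊤ := RootPairing.IsRootSystem.span_coroot_eq_top
    rw [h2, Submodule.map_top, Submodule.range_subtype, Submodule.map_span, image_image] at h1
    rw [← h1]
    congr 1
    ext x
    simp [hh]
  have hA (i j : b.support) : i.1.1 (coroot j.1.1) = (b.cartanMatrix i j : K) := by
    rw [← rootSystem_pairing_apply, ← b.algebraMap_cartanMatrixIn_apply ℤ i j]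
    rfl
  have hcomm (i j : b.support) : ⁅h i, h j⁆ = 0 := by
    rw [hh, hh]
    exact congrArg Subtype.val (trivial_lie_zero H H (coroot i.1.1) (coroot j.1.1))
  have hweight {χ : H → K} {x : L} (hx : x ∈ rootSpace H χ) (j : b.support) :
      ⁅h j, x⁆ = χ (coroot j.1.1) • x := by
    rw [hh, ← lie_eq_smul_of_mem_rootSpace hx]
    rfl
  exact ⟨{
    A := b.cartanMatrix
    h := h
    e := e
    f := f
    cartan_eq_lieSpan := by
      rw [← LieSubalgebra.toSubmodule_inj, hspan,
        LieSubalgebra.coe_lieSpan_eq_span_of_forall_lie_eq_zero]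
      rintro - ⟨i, rfl⟩ - ⟨j, rfl⟩
      exact hcomm i j
    span_ef := by
      refine eq_top_of_rootSpace_le b fun i hi ↦ ⟨fun x hx ↦ ?_, fun x hx ↦ ?_⟩
      · obtain ⟨c, rfl⟩ := exists_smul_eq_of_mem_rootSpace (hb ⟨i, hi⟩) (he ⟨i, hi⟩)
          (t ⟨i, hi⟩).e_ne_zero hx
        exact LieSubalgebra.smul_mem _ _ (LieSubalgebra.subset_lieSpan (by simp))
      · obtain ⟨c, rfl⟩ := exists_smul_eq_of_mem_rootSpace (hb ⟨i, hi⟩).neg (hf ⟨i, hi⟩)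
          (t ⟨i, hi⟩).f_ne_zero hx
        exact LieSubalgebra.smul_mem _ _ (LieSubalgebra.subset_lieSpan (by simp))
    linInd := by
      rw [show h = fun i ↦ (coroot i.1.1 : L) from funext hh]
      exact hlin.map' H.toSubmodule.subtype (Submodule.ker_subtype _)
    nondegen := b.cartanMatrix_nondegenerate
    sl2 := t
    lie_h_h := hcomm
    lie_h_e := fun i j ↦ by rw [hweight (he i), hA, Int.cast_smul_eq_zsmul]
    lie_h_f := fun i j ↦ by
      rw [hweight (hf i), Pi.neg_apply, hA, ← Int.cast_neg, Int.cast_smul_eq_zsmul]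
    -- A nonzero bracket would make the difference of two distinct simple roots a root.
    lie_e_f_ne := fun i j hij ↦ by
      have := lie_mem_genWeightSpace_of_mem_genWeightSpace (he i) (hf j)
      by_contra h0
      have hne : genWeightSpace L (i.1.1 + -j.1.1 : H → K) ≠ ⊥ := fun h ↦ by
        rw [h, LieSubmodule.mem_bot] at this
        exact h0 this
      let χ : Weight K H L := ⟨_, hne⟩
      have hχ : χ.IsNonZero := fun hz ↦ hij <| by
        have h1 : (i.1.1 + -j.1.1 : H → K) = 0 := hz
        exact Subtype.ext (Subtype.ext (Weight.ext fun x ↦ by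
          simpa [add_neg_eq_zero] using congrFun h1 x))
      refine b.sub_notMem_range_root i.2 j.2 ⟨⟨χ, by simpa using hχ⟩, ?_⟩
      ext x
      simp [χ, sub_eq_add_neg] }⟩

variable (H) in
/-- **The Chevalley involution**. -/
theorem exists_chevalleyInvolution :
    ∃ θ : L →ₗ⁅K⁆ L, (∀ x, θ (θ x) = x) ∧ ∀ h ∈ H, θ h = -h := by
  obtain ⟨b⟩ := (rootSystem H).nonempty_base
  obtain ⟨B⟩ := nonempty_basis b
  exact B.exists_involution

end LieAlgebra.IsKilling

end

/-! ### Chevalley systems and integrality of structure constants -/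

noncomputable section
open LieAlgebra LieAlgebra.IsKilling LieModule Module Set

namespace LieAlgebra.IsKilling

variable {K L : Type*} [Field K] [CharZero K] [LieRing L] [LieAlgebra K L] [FiniteDimensional K L]
  [IsKilling K L] {H : LieSubalgebra K L} [H.IsCartanSubalgebra] [IsTriangularizable K H L]

omit [CharZero K] [FiniteDimensional K L] [IsKilling K L] [IsTriangularizable K H L] in
lemma mem_rootSpace_of_forall_lie_eq_smul {χ : H → K} {x : L}
    (h : ∀ y : H, ⁅(y : L), x⁆ = χ y • x) : x ∈ rootSpace H χ :=
  (mem_genWeightSpace _ _ _).mpr fun y ↦ ⟨1, by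
    rw [pow_one, LinearMap.sub_apply, sub_eq_zero]
    exact h y⟩

lemma apply_mem_rootSpace_neg {θ : L →ₗ⁅K⁆ L} (hθ : ∀ h ∈ H, θ h = -h) {χ : H → K} {x : L}
    (hx : x ∈ rootSpace H χ) : θ x ∈ rootSpace H (-χ) := by
  refine mem_rootSpace_of_forall_lie_eq_smul fun y ↦ ?_
  have h1 : ⁅(y : L), x⁆ = χ y • x := lie_eq_smul_of_mem_rootSpace hx y
  have h2 := congrArg θ h1
  rw [LieHom.map_lie, hθ _ y.2, map_smul, neg_lie] at h2
  rw [Pi.neg_apply, neg_smul, ← h2, neg_neg]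

lemma killingForm_apply_ne_zero {α : Weight K H L} (hα : α.IsNonZero) {x y : L}
    (hx : x ∈ rootSpace H α) (hx₀ : x ≠ 0) (hy : y ∈ rootSpace H (-α)) (hy₀ : y ≠ 0) :
    killingForm K L x y ≠ 0 := by
  intro h0
  have : x ∈ LinearMap.ker (killingForm K L) := by
    refine mem_ker_killingForm_of_mem_rootSpace_of_forall_rootSpace_neg K L H hx fun z hz ↦ ?_
    obtain ⟨c, rfl⟩ := exists_smul_eq_of_mem_rootSpace hα.neg hy hy₀ hz
    rw [map_smul, h0, smul_zero]
  rw [ker_killingForm_eq_bot, Submodule.mem_bot] at this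
  exact hx₀ this

lemma killingForm_mul_rootLengthSq {α : Weight K H L} (hα : α.IsNonZero) {x y : L}
    (hx : x ∈ rootSpace H α) (hy : y ∈ rootSpace H (-α)) (hxy : ⁅x, y⁆ = coroot α) :
    killingForm K L x y * rootLengthSq α = 2 := by
  rw [lie_eq_killingForm_smul_of_mem_rootSpace_of_mem_rootSpace_neg hx hy] at hxy
  have h : killingForm K L x y • (cartanEquivDual H).symm α = coroot α := Subtype.ext hxy
  rw [← root_apply_coroot hα, ← h, ← Weight.toLinear_apply, map_smul, smul_eq_mul]
  rfl

lemma lie_eq_coroot_of_killingForm {α : Weight K H L} (hα : α.IsNonZero) {x y : L}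
    (hx : x ∈ rootSpace H α) (hy : y ∈ rootSpace H (-α))
    (hxy : killingForm K L x y * rootLengthSq α = 2) : ⁅x, y⁆ = coroot α := by
  rw [lie_eq_killingForm_smul_of_mem_rootSpace_of_mem_rootSpace_neg hx hy, coroot,
    eq_div_of_mul_eq (rootLengthSq_ne_zero hα) hxy, ← H.coe_smul, ← Nat.cast_smul_eq_nsmul K,
    smul_smul, div_eq_mul_inv]
  rfl

lemma isSl2Triple_of_lie_eq_coroot {α : Weight K H L} (hα : α.IsNonZero) {x y : L}
    (hx : x ∈ rootSpace H α) (hy : y ∈ rootSpace H (-α)) (hxy : ⁅x, y⁆ = coroot α) :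
    IsSl2Triple (coroot α : L) x y where
  h_ne_zero := by simpa using hα
  lie_e_f := hxy
  lie_h_e_nsmul := by
    have h : ⁅(coroot α : L), x⁆ = _ := lie_eq_smul_of_mem_rootSpace hx (coroot α)
    rw [h, root_apply_coroot hα, ofNat_smul_eq_nsmul]
  lie_h_f_nsmul := by
    have h : ⁅(coroot α : L), y⁆ = _ := lie_eq_smul_of_mem_rootSpace hy (coroot α)
    rw [h, Pi.neg_apply, root_apply_coroot hα, neg_smul, ofNat_smul_eq_nsmul]

omit [CharZero K] [IsTriangularizable K H L] in
/-- Twice the value of the Killing form on a normalised pair of root vectors. -/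
lemma two_mul_killingForm_eq {α : Weight K H L} {x y : L}
    (t : IsSl2Triple (coroot α : L) x y) :
    2 * killingForm K L x y = killingForm K L (coroot α : L) (coroot α : L) := by
  have h := LieModule.traceForm_apply_lie_apply K L L x y (coroot α : L)
  rw [t.lie_e_f, ← lie_skew, t.lie_h_f_nsmul, neg_neg, map_nsmul] at h
  rw [two_mul, ← two_nsmul]
  exact h.symm

/-- A family of root vectors adapted to an involution `θ` that acts as `-1` on the Cartan
subalgebra. -/
structure IsChevalleySystem (θ : L →ₗ⁅K⁆ L) (e : Weight K H L → L) : Prop where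
  involutive : ∀ x, θ (θ x) = x
  apply_cartan : ∀ h ∈ H, θ h = -h
  mem : ∀ α : Weight K H L, α.IsNonZero → e α ∈ rootSpace H α
  apply_e : ∀ α : Weight K H L, α.IsNonZero → θ (e α) = -e (-α)
  lie_e_neg : ∀ α : Weight K H L, α.IsNonZero → ⁅e α, e (-α)⁆ = coroot α

variable (H) in
theorem exists_isChevalleySystem [IsAlgClosed K] :
    ∃ (θ : L →ₗ⁅K⁆ L) (e : Weight K H L → L), IsChevalleySystem θ e := by
  classical
  obtain ⟨θ, hθ, hθH⟩ := exists_chevalleyInvolution H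
  have key (α : Weight K H L) (hα : α.IsNonZero) :
      ∃ x ∈ rootSpace H α, ⁅x, -θ x⁆ = coroot α := by
    obtain ⟨x, hx, hx₀⟩ := α.exists_ne_zero
    have hy : -θ x ∈ rootSpace H (-α : H → K) := neg_mem (apply_mem_rootSpace_neg hθH hx)
    have hy₀ : -θ x ≠ 0 := fun h ↦ hx₀ <| by
      rw [neg_eq_zero] at h
      rw [← hθ x, h, map_zero]
    have h0 := killingForm_apply_ne_zero hα hx hx₀ hy hy₀
    have h1 := rootLengthSq_ne_zero hα
    -- Rescaling `x` by `c` multiplies `κ(x, -θx)` by `c²`, so a square root achieves the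
    -- normalisation that makes the bracket the coroot.
    obtain ⟨c, hc⟩ := IsAlgClosed.exists_pow_nat_eq
      (2 / (killingForm K L x (-θ x) * rootLengthSq α)) two_pos
    refine ⟨c • x, Submodule.smul_mem _ c hx, ?_⟩
    rw [map_smul, ← smul_neg]
    refine lie_eq_coroot_of_killingForm hα (Submodule.smul_mem _ c hx)
      (Submodule.smul_mem _ c hy) ?_
    rw [map_smul, map_smul, LinearMap.smul_apply, smul_eq_mul, smul_eq_mul, ← mul_assoc, ← sq, hc]
    field_simp
  choose! E hE hE' using key
  have hne {α : Weight K H L} (hα : α.IsNonZero) : α ≠ -α := fun h ↦ hα <| by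
    have h1 : (α : H → K) = -α := congrArg _ h
    ext x
    simpa [self_eq_neg] using congrFun h1 x
  -- Only a choice of one root from each pair `±α` is needed. An arbitrary well-order supplies it;
  -- no notion of positive root is involved.
  let pos (α : Weight K H L) : Prop := WellOrderingRel α (-α)
  have hpos {α : Weight K H L} (h : pos α) : ¬ pos (-α) := by
    simp only [pos, neg_neg]
    exact asymm h
  have hpos' {α : Weight K H L} (hα : α.IsNonZero) (h : ¬ pos α) : pos (-α) := by
    simp only [pos, neg_neg]
    exact ((trichotomous_of WellOrderingRel α (-α)).resolve_left h).resolve_left (hne hα)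
  refine ⟨θ, fun α ↦ if pos α then E α else -θ (E (-α)), hθ, hθH, fun α hα ↦ ?_,
    fun α hα ↦ ?_, fun α hα ↦ ?_⟩
  · by_cases h : pos α
    · simpa only [if_pos h] using hE α hα
    · simp only [if_neg h]
      have := apply_mem_rootSpace_neg hθH (hE (-α) hα.neg)
      rw [Weight.coe_neg, neg_neg] at this
      exact neg_mem this
  · by_cases h : pos α
    · simp only [if_pos h, if_neg (hpos h), neg_neg]
    · simp only [if_neg h, if_pos (hpos' hα h), map_neg, hθ]
  · by_cases h : pos α
    · simp only [if_pos h, if_neg (hpos h), neg_neg]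
      exact hE' α hα
    · simp only [if_neg h, if_pos (hpos' hα h)]
      rw [← lie_skew, hE' _ hα.neg, coroot_neg]
      simp

namespace IsChevalleySystem

variable {θ : L →ₗ⁅K⁆ L} {e : Weight K H L → L} (C : IsChevalleySystem θ e)
include C

lemma isSl2Triple {α : Weight K H L} (hα : α.IsNonZero) :
    IsSl2Triple (coroot α : L) (e α) (e (-α)) :=
  isSl2Triple_of_lie_eq_coroot hα (C.mem α hα) (C.mem (-α) hα.neg) (C.lie_e_neg α hα)

lemma ne_zero {α : Weight K H L} (hα : α.IsNonZero) : e α ≠ 0 := (C.isSl2Triple hα).e_ne_zero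

/-- The structure constants of a Chevalley system are integers. -/
lemma exists_int_lie_eq_smul {α β γ : Weight K H L} (hα : α.IsNonZero) (hβ : β.IsNonZero)
    (hγ : γ.IsNonZero) (h : (γ : H → K) = α + β) : ∃ n : ℤ, ⁅e α, e β⁆ = n • e γ := by
  have hmem : ⁅e α, e β⁆ ∈ rootSpace H γ := by
    rw [h]
    exact lie_mem_genWeightSpace_of_mem_genWeightSpace (C.mem α hα) (C.mem β hβ)
  obtain ⟨N, hN⟩ := exists_smul_eq_of_mem_rootSpace hγ (C.mem γ hγ) (C.ne_zero hγ) hmem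
  have hmem' : ⁅e (-α), e γ⁆ ∈ rootSpace H β := by
    have := lie_mem_genWeightSpace_of_mem_genWeightSpace (C.mem (-α) hα.neg) (C.mem γ hγ)
    rwa [Weight.coe_neg, h, neg_add_cancel_left] at this
  obtain ⟨M, hM⟩ := exists_smul_eq_of_mem_rootSpace hβ (C.mem β hβ) (C.ne_zero hβ) hmem'
  -- Here the adaptation to θ enters: it ties the constant for `(-α, -β)` to the one for `(α, β)`,
  -- which leaves only a sign ambiguity at the end.
  have hNneg : ⁅e (-α), e (-β)⁆ = -(N • e (-γ)) := by
    have := congrArg θ hN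
    rw [map_smul, LieHom.map_lie, C.apply_e _ hα, C.apply_e _ hβ, C.apply_e _ hγ, neg_lie, lie_neg,
      neg_neg, smul_neg] at this
    exact this.symm
  have hNM : N * M = chainTopCoeff α β * (chainBotCoeff α β + 1) := by
    have := lie_lie_eq_smul_of_isSl2Triple hα hβ (C.isSl2Triple hα) (C.mem α hα)
      (C.mem (-α) hα.neg) (C.mem β hβ)
    rw [← hN, lie_smul, ← hM, smul_smul] at this
    exact smul_left_injective K (C.ne_zero hβ) this
  have hκ : M * killingForm K L (e β) (e (-β)) = N * killingForm K L (e γ) (e (-γ)) := by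
    have := LieModule.traceForm_apply_lie_apply K L L (e γ) (e (-α)) (e (-β))
    rw [← lie_skew, ← hM, hNneg] at this
    simpa using this
  have hβl := killingForm_mul_rootLengthSq hβ (C.mem β hβ) (C.mem (-β) hβ.neg) (C.lie_e_neg β hβ)
  have hγl := killingForm_mul_rootLengthSq hγ (C.mem γ hγ) (C.mem (-γ) hγ.neg) (C.lie_e_neg γ hγ)
  have hr := chainTopCoeff_mul_rootLengthSq hα hβ hγ h
  have hβ₀ := rootLengthSq_ne_zero hβ
  have hγ₀ := rootLengthSq_ne_zero hγ
  have hMN : M * rootLengthSq γ = N * rootLengthSq β := by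
    have h2 : M * rootLengthSq γ * (2 : K) = N * rootLengthSq β * 2 := by
      linear_combination (-M * rootLengthSq γ) * hβl + (N * rootLengthSq β) * hγl +
        rootLengthSq β * rootLengthSq γ * hκ
    exact mul_right_cancel₀ two_ne_zero h2
  -- Writing `|·|²` for `rootLengthSq`: `N²|β|² = NM|γ|² = q(p + 1)|γ|² = (p + 1)²|β|²`.
  have hsq : N ^ 2 = ((chainBotCoeff α β : K) + 1) ^ 2 := by
    have : N ^ 2 * rootLengthSq β = ((chainBotCoeff α β : K) + 1) ^ 2 * rootLengthSq β := by
      linear_combination -N * hMN + rootLengthSq γ * hNM + ((chainBotCoeff α β : K) + 1) * hr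
    exact mul_right_cancel₀ hβ₀ this
  rcases sq_eq_sq_iff_eq_or_eq_neg.mp hsq with hN' | hN'
  · refine ⟨chainBotCoeff α β + 1, ?_⟩
    rw [← hN, hN', ← Int.cast_smul_eq_zsmul K]
    push_cast
    rfl
  · refine ⟨-(chainBotCoeff α β + 1), ?_⟩
    rw [← hN, hN', ← Int.cast_smul_eq_zsmul K]
    push_cast
    rfl

end IsChevalleySystem

end LieAlgebra.IsKilling

end

/-! ### The Chevalley basis and its integral span -/

noncomputable section
open LieAlgebra LieAlgebra.IsKilling LieModule Module Set

namespace LieAlgebra.IsKilling.IsChevalleySystem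

variable {K L : Type*} [Field K] [CharZero K] [LieRing L] [LieAlgebra K L] [FiniteDimensional K L]
  [IsKilling K L] {H : LieSubalgebra K L} [H.IsCartanSubalgebra] [IsTriangularizable K H L]
  {θ : L →ₗ⁅K⁆ L} {e : Weight K H L → L}

/-- The simple coroots together with the root vectors of a Chevalley system. -/
def basisVector (e : Weight K H L → L) (b : (rootSystem H).Base) : b.support ⊕ H.root → L :=
  Sum.elim (fun i ↦ (coroot i.1.1 : L)) (fun α ↦ e α.1)

/-- The weight of a basis vector. -/
def basisWeight (b : (rootSystem H).Base) : b.support ⊕ H.root → Dual K H :=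
  Sum.elim 0 (fun α ↦ α.1.toLinear)

section

variable (C : IsChevalleySystem θ e) (b : (rootSystem H).Base)
include C

lemma lie_basisVector (h : H) (i : b.support ⊕ H.root) :
    ⁅(h : L), basisVector e b i⁆ = basisWeight b i h • basisVector e b i := by
  rcases i with i | α
  · simpa [basisWeight] using! congrArg Subtype.val (trivial_lie_zero H H h (coroot i.1.1))
  · exact lie_eq_smul_of_mem_rootSpace (C.mem α.1 (H.isNonZero_coe_root α)) h

omit [CharZero K] in
lemma killingForm_e_e {α β : Weight K H L} (hα : α.IsNonZero) (hβ : β.IsNonZero) (h : β ≠ -α) :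
    killingForm K L (e α) (e β) = 0 := by
  refine killingForm_apply_eq_zero_of_mem_rootSpace_of_add_ne_zero K L H (C.mem α hα) (C.mem β hβ)
    fun h0 ↦ h ?_
  exact Weight.ext fun x ↦ (neg_eq_of_add_eq_zero_right (congrFun h0 x)).symm

omit [CharZero K] in
lemma killingForm_cartan_e {α : Weight K H L} (hα : α.IsNonZero) {h : L} (hh : h ∈ H) :
    killingForm K L h (e α) = 0 := by
  refine killingForm_apply_eq_zero_of_mem_rootSpace_of_add_ne_zero K L H (α := 0) ?_ (C.mem α hα)
    (by simpa using hα)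
  rw [rootSpace_zero_eq]
  exact hh

lemma killingForm_e_neg_ne_zero {α : Weight K H L} (hα : α.IsNonZero) :
    killingForm K L (e α) (e (-α)) ≠ 0 :=
  killingForm_apply_ne_zero hα (C.mem α hα) (C.ne_zero hα) (C.mem (-α) hα.neg) (C.ne_zero hα.neg)

/-- Pairing a relation with `e (-α)` under the Killing form isolates the coefficient of `e α`. What
remains is a relation among simple coroots. -/
lemma linearIndependent_basisVector : LinearIndependent K (basisVector e b) := by
  classical
  rw [Fintype.linearIndependent_iff]
  intro c hc
  rw [Fintype.sum_sum_type] at hc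
  have hmem : ∑ i : b.support, c (.inl i) • (coroot i.1.1 : L) ∈ H :=
    sum_mem fun i _ ↦ H.smul_mem _ (coroot i.1.1).2
  have hroot (α : H.root) : c (.inr α) = 0 := by
    have hα := H.isNonZero_coe_root α
    have h0 := congrArg (fun x ↦ killingForm K L x (e (-α.1))) hc
    simp only [basisVector, Sum.elim_inl, Sum.elim_inr, map_add, LinearMap.add_apply, map_zero,
      LinearMap.zero_apply] at h0
    rw [C.killingForm_cartan_e hα.neg hmem, zero_add, map_sum, LinearMap.sum_apply,
      Finset.sum_eq_single α] at h0
    · rw [map_smul, LinearMap.smul_apply, smul_eq_mul] at h0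
      exact (mul_eq_zero.mp h0).resolve_right (C.killingForm_e_neg_ne_zero hα)
    · intro β _ hβ
      rw [map_smul, LinearMap.smul_apply, C.killingForm_e_e (H.isNonZero_coe_root β) hα.neg,
        smul_zero]
      exact fun h ↦ hβ (Subtype.ext (neg_injective h).symm)
    · simp
  rintro (i | α)
  · have hlin : LinearIndependent K fun i : b.support ↦ coroot i.1.1 := b.linearIndepOn_coroot
    refine Fintype.linearIndependent_iff.mp hlin (fun i ↦ c (.inl i)) (Subtype.ext ?_) i
    simpa [basisVector, hroot] using hc
  · exact hroot α

omit C in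
lemma span_coroot_base :
    Submodule.span K (range fun i : b.support ↦ (coroot i.1.1 : L)) = H.toSubmodule := by
  have h1 := congrArg (Submodule.map H.toSubmodule.subtype) b.span_coroot_support
  have h2 : (rootSystem H).corootSpan K = ⊤ := RootPairing.IsRootSystem.span_coroot_eq_top
  rw [h2, Submodule.map_top, Submodule.range_subtype, Submodule.map_span, image_image] at h1
  rw [← h1]
  congr 1
  ext x
  simp

lemma span_basisVector : Submodule.span K (range (basisVector e b)) = ⊤ := by
  rw [eq_top_iff]
  intro x _
  have hx : x ∈ (⨆ χ : Weight K H L, genWeightSpace L χ).toSubmodule := by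
    rw [iSup_genWeightSpace_eq_top' K H L]
    trivial
  rw [LieSubmodule.iSup_toSubmodule] at hx
  refine (iSup_le fun χ ↦ ?_ : _ ≤ Submodule.span K (range (basisVector e b))) hx
  by_cases hχ : χ.IsZero
  · rw [hχ, show genWeightSpace L (0 : H → K) = rootSpace H 0 from rfl, rootSpace_zero_eq]
    change H.toSubmodule ≤ _
    rw [← span_coroot_base b]
    refine Submodule.span_mono ?_
    rintro _ ⟨i, rfl⟩
    exact ⟨.inl i, rfl⟩
  · intro y hy
    obtain ⟨c, rfl⟩ := exists_smul_eq_of_mem_rootSpace hχ (C.mem χ hχ) (C.ne_zero hχ) hy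
    exact Submodule.smul_mem _ _ (Submodule.subset_span ⟨.inr ⟨χ, by simpa using hχ⟩, rfl⟩)

/-- The Chevalley basis attached to a Chevalley system and a base of the root system. -/
def basis : Module.Basis (b.support ⊕ H.root) K L :=
  .mk (C.linearIndependent_basisVector b) (C.span_basisVector b).ge

@[simp] lemma coe_basis : ⇑(C.basis b) = basisVector e b := Basis.coe_mk _ _

lemma coroot_mem_span_int (α : H.root) :
    (coroot α.1 : L) ∈ Submodule.span ℤ (range (C.basis b)) := by
  have h := Submodule.mem_map_of_mem (f := H.toSubmodule.subtype.restrictScalars ℤ)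
    (b.coroot_mem_span_int α)
  rw [Submodule.map_span, image_image] at h
  refine Submodule.span_mono ?_ h
  rintro _ ⟨i, hi, rfl⟩
  exact ⟨.inl ⟨i, hi⟩, by simp [basisVector]⟩

lemma e_mem_span_int (α : Weight K H L) (hα : α.IsNonZero) :
    e α ∈ Submodule.span ℤ (range (C.basis b)) :=
  Submodule.subset_span ⟨.inr ⟨α, by simpa using hα⟩, by simp [basisVector]⟩

lemma apply_basis_mem (i : b.support ⊕ H.root) :
    θ (C.basis b i) ∈ Submodule.span ℤ (range (C.basis b)) := by
  rcases i with i | α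
  · rw [C.coe_basis, basisVector, Sum.elim_inl, ← basisVector, ← C.coe_basis b,
      C.apply_cartan _ (coroot i.1.1).2]
    exact neg_mem (C.coroot_mem_span_int b i.1)
  · rw [C.coe_basis, basisVector, Sum.elim_inr, ← basisVector, ← C.coe_basis b,
      C.apply_e _ (H.isNonZero_coe_root α)]
    exact neg_mem (C.e_mem_span_int b _ (H.isNonZero_coe_root α).neg)

lemma lie_coroot_e_mem (i : b.support) (α : H.root) :
    ⁅(coroot i.1.1 : L), e α.1⁆ ∈ Submodule.span ℤ (range (C.basis b)) := by
  have h : ⁅(coroot i.1.1 : L), e α.1⁆ = _ :=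
    lie_eq_smul_of_mem_rootSpace (C.mem α.1 (H.isNonZero_coe_root α)) (coroot i.1.1)
  rw [h, apply_coroot_eq_cast, Int.cast_smul_eq_zsmul]
  exact zsmul_mem (C.e_mem_span_int b _ (H.isNonZero_coe_root α)) _

/-- Three integrality facts are combined: roots take integral values on coroots, every coroot is an
integral combination of simple ones, and the structure constants are integers. -/
lemma lie_basis_mem (i j : b.support ⊕ H.root) :
    ⁅C.basis b i, C.basis b j⁆ ∈ Submodule.span ℤ (range (C.basis b)) := by
  rcases i with i | α <;> rcases j with j | β
  · have h := C.lie_basisVector b (coroot i.1.1) (.inl j)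
    simp only [basisWeight, Sum.elim_inl, Pi.zero_apply, LinearMap.zero_apply, zero_smul] at h
    rw [coe_basis, show basisVector e b (.inl i) = (coroot i.1.1 : L) from rfl, h]
    exact zero_mem _
  · have := C.lie_coroot_e_mem b i β
    simpa [basisVector] using this
  · have := neg_mem (C.lie_coroot_e_mem b j α)
    rw [lie_skew] at this
    simpa [basisVector] using this
  · have hα := H.isNonZero_coe_root α
    have hβ := H.isNonZero_coe_root β
    suffices h : ⁅e α.1, e β.1⁆ ∈ Submodule.span ℤ (range (C.basis b)) by
      simpa [basisVector] using h
    by_cases h0 : β.1 = -α.1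
    · rw [h0, C.lie_e_neg _ hα]
      exact C.coroot_mem_span_int b α
    by_cases h1 : rootSpace H (α.1 + β.1 : H → K) = ⊥
    · have := lie_mem_genWeightSpace_of_mem_genWeightSpace (C.mem _ hα) (C.mem _ hβ)
      rw [show genWeightSpace L (α.1 + β.1 : H → K) = ⊥ from h1, LieSubmodule.mem_bot] at this
      rw [this]
      exact zero_mem _
    · let γ : Weight K H L := ⟨_, h1⟩
      have hγ : γ.IsNonZero := fun hz ↦ h0 <|
        Weight.ext fun x ↦ (neg_eq_of_add_eq_zero_right (congrFun hz x)).symm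
      obtain ⟨n, hn⟩ := C.exists_int_lie_eq_smul hα hβ hγ rfl
      rw [hn]
      exact zsmul_mem (C.e_mem_span_int b _ hγ) n

-- The basis is that of fundamental coweights, dual to the simple roots. Integrality of all weights
-- on it will turn exponentials of the torus into monomials, while the simple roots recover the
-- coordinates.
omit C in
lemma exists_basis_cartan :
    ∃ y : Module.Basis b.support K H,
      (∀ i j, ∃ n : ℤ, basisWeight b i (y j) = n) ∧
      ∀ j, ∃ i, ∀ h, basisWeight b i h = y.repr h j := by
  classical
  let w : Module.Basis b.support K (Dual K H) := b.toWeightBasis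
  have hw (i : b.support) : w i = i.1.1.toLinear := b.toWeightBasis_apply i
  let y : Module.Basis b.support K H := w.dualBasis.map (evalEquiv K H).symm
  have hy (i j : b.support) : Weight.toLinear K H L i.1.1 (y j) = if i = j then 1 else 0 := by
    rw [← hw, Basis.map_apply, apply_evalEquiv_symm_apply, Basis.dualBasis_apply_self]
  refine ⟨y, ?_, fun j ↦ ⟨.inr j.1, fun h ↦ ?_⟩⟩
  · rintro (i | α) j
    · exact ⟨0, by simp [basisWeight]⟩
    · obtain ⟨f, -, -, hf⟩ := b.exists_root_eq_sum_int α
      refine ⟨f j.1, ?_⟩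
      have hf' : α.1.toLinear = ∑ i : b.support, f i.1 • Weight.toLinear K H L i.1.1 :=
        hf.trans (Finset.sum_coe_sort b.support fun i ↦ f i • (rootSystem H).root i).symm
      simp only [basisWeight, Sum.elim_inr]
      rw [hf', LinearMap.sum_apply, Finset.sum_eq_single j]
      · simp [hy]
      · intro i _ hi
        simp [hy, hi]
      · simp
  · conv_lhs => rw [← y.sum_repr h]
    simp only [basisWeight, Sum.elim_inr]
    rw [map_sum, Finset.sum_eq_single j]
    · simp [hy]
    · intro i _ hi
      simp [hy, hi.symm]
    · simp

end

end LieAlgebra.IsKilling.IsChevalleySystem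

end

/-! ### Base change of Lie algebras and real forms from conjugations -/

noncomputable section
open Module

/-- A map out of a base change that respects the brackets of pure tensors respects all brackets. -/
lemma LieAlgebra.map_lie_of_forall_tmul {R S L L' : Type*} [CommRing R] [CommRing S] [Algebra R S]
    [LieRing L] [LieAlgebra R L] [LieRing L'] (f : (S ⊗[R] L) →+ L')
    (hf : ∀ (s t : S) (x y : L), f ((s * t) ⊗ₜ ⁅x, y⁆) = ⁅f (s ⊗ₜ x), f (t ⊗ₜ y)⁆)
    (u v : S ⊗[R] L) : f ⁅u, v⁆ = ⁅f u, f v⁆ := by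
  induction u with
  | zero => simp
  | add s s' hs hs' => simp only [add_lie, map_add, hs, hs']
  | tmul s x =>
    induction v with
    | zero => rw [show ⁅s ⊗ₜ[R] x, (0 : S ⊗[R] L)⁆ = 0 from lie_zero _, map_zero, lie_zero]
    | add v v' hv hv' =>
      rw [show ⁅s ⊗ₜ[R] x, v + v'⁆ = ⁅s ⊗ₜ[R] x, v⁆ + ⁅s ⊗ₜ[R] x, v'⁆ from lie_add _ _ _,
        map_add, map_add, lie_add, hv, hv']
    | tmul t y => exact hf s t x y

namespace LieAlgebra

variable {R S L L' : Type*} [CommRing R] [CommRing S] [Algebra R S] [LieRing L] [LieAlgebra R L]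
  [LieRing L'] [LieAlgebra S L']

/-- A linear equivalence on the base change of a Lie algebra that respects the brackets of the
original Lie algebra is an equivalence of Lie algebras. -/
def lieEquivOfBaseChange (f : (S ⊗[R] L) ≃ₗ[S] L')
    (hf : ∀ x y : L, f (1 ⊗ₜ ⁅x, y⁆) = ⁅f (1 ⊗ₜ x), f (1 ⊗ₜ y)⁆) : (S ⊗[R] L) ≃ₗ⁅S⁆ L' :=
  { f with
    map_lie' := by
      have hsmul (s : S) (x : L) : f (s ⊗ₜ x) = s • f (1 ⊗ₜ x) := by
        rw [← map_smul, TensorProduct.smul_tmul', smul_eq_mul, mul_one]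
      intro u v
      refine map_lie_of_forall_tmul f.toLinearMap.toAddMonoidHom (fun s t x y ↦ ?_) u v
      change f ((s * t) ⊗ₜ ⁅x, y⁆) = ⁅f (s ⊗ₜ x), f (t ⊗ₜ y)⁆
      rw [hsmul, hsmul s, hsmul t, smul_lie, lie_smul, smul_smul, hf] }

theorem killingForm_apply_lieEquiv_baseChange [Module.Free R L] [Module.Finite R L]
    (f : (S ⊗[R] L) ≃ₗ⁅S⁆ L') (x y : L) :
    killingForm S L' (f (1 ⊗ₜ x)) (f (1 ⊗ₜ y)) = algebraMap R S (killingForm R L x y) := by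
  rw [LieAlgebra.killingForm_of_equiv_apply]
  have h := LieModule.traceForm_baseChange R L L S
  have h' : killingForm S (S ⊗[R] L) = (LieModule.traceForm R L L).baseChange S := h
  rw [h', LinearMap.BilinForm.baseChange_tmul, Algebra.algebraMap_eq_smul_one]
  simp

end LieAlgebra

/-- A conjugation of a complex Lie algebra: an antilinear involutive automorphism. -/
structure IsLieConjugation {g : Type*} [LieRing g] [LieAlgebra ℂ g]
    (σ : g →ₛₗ[starRingEnd ℂ] g) : Prop where
  involutive : ∀ x, σ (σ x) = x
  map_lie : ∀ x y, σ ⁅x, y⁆ = ⁅σ x, σ y⁆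

namespace IsLieConjugation

variable {g : Type*} [LieRing g] [LieAlgebra ℂ g] {σ : g →ₛₗ[starRingEnd ℂ] g}

/-- The real subalgebra of fixed points of a conjugation. -/
def fixed (hσ : IsLieConjugation σ) : LieSubalgebra ℝ g where
  carrier := {x | σ x = x}
  add_mem' {x y} hx hy := by
    change σ x = x at hx
    change σ y = y at hy
    change σ (x + y) = x + y
    rw [map_add, hx, hy]
  zero_mem' := map_zero σ
  smul_mem' r x hx := by
    change σ x = x at hx
    change σ (r • x) = r • x
    rw [← Complex.coe_smul, map_smulₛₗ, Complex.conj_ofReal, hx]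
  lie_mem' {x y} hx hy := by
    change σ x = x at hx
    change σ y = y at hy
    change σ ⁅x, y⁆ = ⁅x, y⁆
    rw [hσ.map_lie, hx, hy]

variable (hσ : IsLieConjugation σ)

lemma mem_fixed {x : g} : x ∈ hσ.fixed ↔ σ x = x := Iff.rfl

@[simp] lemma apply_coe (x : hσ.fixed) : σ x = x := x.2

/-- The projection of a complex Lie algebra onto the fixed points of a conjugation. -/
def re : g →ₗ[ℝ] hσ.fixed where
  toFun x := ⟨(2⁻¹ : ℂ) • (x + σ x), by
    rw [mem_fixed, map_smulₛₗ, map_add, hσ.involutive, add_comm (σ x), map_inv₀, map_ofNat]⟩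
  map_add' x y := Subtype.ext <| by
    change (2⁻¹ : ℂ) • (x + y + σ (x + y)) = (2⁻¹ : ℂ) • (x + σ x) + (2⁻¹ : ℂ) • (y + σ y)
    rw [map_add]
    module
  map_smul' r x := Subtype.ext <| by
    change (2⁻¹ : ℂ) • (r • x + σ (r • x)) = r • (2⁻¹ : ℂ) • (x + σ x)
    rw [← Complex.coe_smul, ← Complex.coe_smul, map_smulₛₗ, Complex.conj_ofReal]
    module

lemma coe_re (x : g) : (hσ.re x : g) = (2⁻¹ : ℂ) • (x + σ x) := rfl

@[simp] lemma re_coe (x : hσ.fixed) : hσ.re x = x := Subtype.ext <| by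
  rw [coe_re, apply_coe, ← two_smul ℂ, smul_smul, inv_mul_cancel₀ two_ne_zero, one_smul]

lemma re_smul_coe (z : ℂ) (x : hσ.fixed) : hσ.re (z • (x : g)) = z.re • x := Subtype.ext <| by
  change _ = z.re • (x : g)
  rw [coe_re, map_smulₛₗ, apply_coe, ← add_smul, smul_smul, Complex.add_conj, ← Complex.coe_smul]
  congr 1
  push_cast
  ring

lemma re_add_I_smul_re (x : g) :
    (hσ.re x : g) + Complex.I • (hσ.re (-Complex.I • x) : g) = x := by
  have h2 : Complex.I * 2⁻¹ * -Complex.I = 2⁻¹ := by linear_combination -2⁻¹ * Complex.I_sq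
  have h3 : Complex.I * 2⁻¹ * Complex.I = -2⁻¹ := by linear_combination 2⁻¹ * Complex.I_sq
  rw [coe_re, coe_re, map_smulₛₗ, map_neg, Complex.conj_I, neg_neg]
  rw [smul_add, smul_add, smul_add, smul_smul, smul_smul, smul_smul, smul_smul, h2, h3]
  module

/-- A complex Lie algebra is the complexification of the fixed points of a conjugation. -/
def linearEquiv : (ℂ ⊗[ℝ] hσ.fixed) ≃ₗ[ℂ] g :=
  LinearEquiv.ofBijective
    (LinearMap.liftBaseChange ℂ (hσ.fixed.toSubmodule.subtype)) <| by
    -- The inverse is explicit: `x ↦ 1 ⊗ re x + I ⊗ re (-I x)`, the splitting into real and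
    -- imaginary parts.
    have key : ∀ t : ℂ ⊗[ℝ] hσ.fixed,
        (1 : ℂ) ⊗ₜ[ℝ] hσ.re (LinearMap.liftBaseChange ℂ (hσ.fixed.toSubmodule.subtype) t) +
          Complex.I ⊗ₜ[ℝ] hσ.re (-Complex.I • LinearMap.liftBaseChange ℂ
            (hσ.fixed.toSubmodule.subtype) t) = t := by
      intro t
      induction t with
      | zero => simp
      | add s t hs ht =>
        nth_rw 3 [← hs, ← ht]
        simp only [map_add, smul_add, TensorProduct.tmul_add]
        abel
      | tmul z x =>
        rw [LinearMap.liftBaseChange_tmul]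
        change (1 : ℂ) ⊗ₜ[ℝ] hσ.re (z • (x : g)) +
          Complex.I ⊗ₜ[ℝ] hσ.re (-Complex.I • z • (x : g)) = _
        rw [smul_smul, re_smul_coe, re_smul_coe, ← TensorProduct.smul_tmul,
          ← TensorProduct.smul_tmul, ← TensorProduct.add_tmul]
        congr 1
        apply Complex.ext <;> simp
    refine ⟨fun s t h => ?_, fun x => ⟨1 ⊗ₜ hσ.re x + Complex.I ⊗ₜ hσ.re (-Complex.I • x), ?_⟩⟩
    · rw [← key s, ← key t, h]
    · rw [map_add, LinearMap.liftBaseChange_tmul, LinearMap.liftBaseChange_tmul, one_smul]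
      exact hσ.re_add_I_smul_re x

@[simp] lemma linearEquiv_tmul (z : ℂ) (x : hσ.fixed) :
    hσ.linearEquiv (z ⊗ₜ x) = z • (x : g) := rfl

theorem isRealForm : IsRealForm hσ.fixed :=
  IsBaseChange.of_equiv hσ.linearEquiv fun x => one_smul ℂ (x : g)

/-- The complexification of the fixed points of a conjugation, as a Lie algebra. -/
def lieEquiv : (ℂ ⊗[ℝ] hσ.fixed) ≃ₗ⁅ℂ⁆ g :=
  LieAlgebra.lieEquivOfBaseChange hσ.linearEquiv fun x y => by
    simp only [linearEquiv_tmul, one_smul]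
    rfl

@[simp] lemma lieEquiv_tmul (z : ℂ) (x : hσ.fixed) :
    hσ.lieEquiv (z ⊗ₜ x) = z • (x : g) := rfl

instance [FiniteDimensional ℂ g] : FiniteDimensional ℝ hσ.fixed :=
  haveI : FiniteDimensional ℝ g := Module.Finite.trans ℂ g
  Module.Finite.of_injective hσ.fixed.toSubmodule.subtype Subtype.val_injective

theorem ofReal_killingForm [FiniteDimensional ℂ g] (x y : hσ.fixed) :
    (killingForm ℝ hσ.fixed x y : ℂ) = killingForm ℂ g x y := by
  have h := LieAlgebra.killingForm_apply_lieEquiv_baseChange hσ.lieEquiv x y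
  rw [lieEquiv_tmul, lieEquiv_tmul, one_smul, one_smul] at h
  exact h.symm

/-- A σ-stable complex subspace contains the real and imaginary parts of its elements, so its real
points span it. This one criterion serves the Cartan subalgebra, the even part and the odd part. -/
theorem complexSpan_eq (s : Submodule ℝ hσ.fixed) (S : Submodule ℂ g)
    (hS : ∀ x ∈ S, σ x ∈ S) (h : ∀ x : hσ.fixed, x ∈ s ↔ (x : g) ∈ S) : complexSpan s = S := by
  refine le_antisymm (Submodule.span_le.2 ?_) fun x hx => ?_
  · rintro _ ⟨x, hx, rfl⟩
    exact (h x).1 hx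
  · have key : ∀ y ∈ S, ((hσ.re y : hσ.fixed) : g) ∈ complexSpan s := fun y hy =>
      Submodule.subset_span ⟨_, (h _).2 (by
        rw [coe_re]; exact S.smul_mem _ (S.add_mem hy (hS y hy))), rfl⟩
    rw [← hσ.re_add_I_smul_re x]
    exact add_mem (key x hx) (Submodule.smul_mem _ _ (key _ (S.smul_mem _ hx)))

end IsLieConjugation

end

/-! ### Diagonal operators and coordinate conjugation -/

noncomputable section
open Module

namespace Module.Basis

section Diagonal

variable {R M ι : Type*} [CommRing R] [AddCommGroup M] [Module R M] (v : Basis ι R M)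

lemma induction_smul {p : M → Prop} (x : M) (zero : p 0) (add : ∀ x y, p x → p y → p (x + y))
    (smul : ∀ (a : R) (i : ι), p (a • v i)) : p x := by
  rw [← v.linearCombination_repr x, Finsupp.linearCombination_apply, Finsupp.sum]
  exact Finset.sum_induction _ p add zero fun i _ ↦ smul _ i

/-- The endomorphism that is diagonal in a given basis. -/
def diagonal (c : ι → R) : M →ₗ[R] M := v.constr R fun i ↦ c i • v i

@[simp] lemma diagonal_apply_basis (c : ι → R) (i : ι) : v.diagonal c (v i) = c i • v i :=
  v.constr_basis R _ i

lemma repr_diagonal (c : ι → R) (x : M) (i : ι) :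
    v.repr (v.diagonal c x) i = c i * v.repr x i := by
  classical
  induction x using v.induction_smul with
  | zero => simp
  | add x y hx hy => simp [hx, hy, mul_add]
  | smul a j => 
    rw [map_smul, diagonal_apply_basis]
    by_cases h : j = i <;> simp [h, mul_comm]

lemma diagonal_comp (c d : ι → R) (x : M) :
    v.diagonal c (v.diagonal d x) = v.diagonal (c * d) x := by
  refine v.ext_elem fun i ↦ ?_
  simp only [repr_diagonal, Pi.mul_apply, mul_assoc]

@[simp] lemma diagonal_one (x : M) : v.diagonal 1 x = x := by
  refine v.ext_elem fun i ↦ ?_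
  simp [repr_diagonal]

end Diagonal

section Lie

variable {R S M N ι : Type*} [CommRing R] [CommRing S] [LieRing M] [LieAlgebra R M] [LieRing N]
  [LieAlgebra S N] {τ : R →+* S} (v : Basis ι R M)

/-- A semilinear map that respects the brackets of basis vectors respects all brackets. -/
lemma map_lie_of_forall_basis (f : M →ₛₗ[τ] N) (hf : ∀ i j, f ⁅v i, v j⁆ = ⁅f (v i), f (v j)⁆)
    (x y : M) : f ⁅x, y⁆ = ⁅f x, f y⁆ := by
  induction x using v.induction_smul with
  | zero => simp
  | add x y hx hy => simp [hx, hy]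
  | smul a i =>
    induction y using v.induction_smul with
    | zero => simp
    | add x y hx hy => simp only [lie_add, map_add, hx, hy]
    | smul b j => simp only [lie_smul, smul_lie, map_smulₛₗ, hf]

end Lie

section Conj

variable {M ι : Type*} [AddCommGroup M] [Module ℂ M] (v : Basis ι ℂ M)

/-- The complex conjugation of the coordinates in a given basis. -/
def conj : M →ₛₗ[starRingEnd ℂ] M where
  toFun x := v.repr.symm ((v.repr x).mapRange (starRingEnd ℂ) (map_zero _))
  map_add' x y := by rw [map_add, Finsupp.mapRange_add (map_add _), map_add]
  map_smul' c x := by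
    rw [← map_smul, map_smul]
    congr 1
    ext i
    simp

@[simp] lemma repr_conj (x : M) (i : ι) : v.repr (v.conj x) i = starRingEnd ℂ (v.repr x i) := by
  simp [conj]

@[simp] lemma conj_apply_basis (i : ι) : v.conj (v i) = v i := by
  classical
  refine v.ext_elem fun j ↦ ?_
  rw [repr_conj, v.repr_self, Finsupp.single_apply]
  split_ifs <;> simp

@[simp] lemma conj_conj (x : M) : v.conj (v.conj x) = x := by
  refine v.ext_elem fun j ↦ ?_
  simp

lemma conj_eq_of_mem_span_int {x : M} (hx : x ∈ Submodule.span ℤ (Set.range v)) :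
    v.conj x = x := by
  induction hx using Submodule.span_induction with
  | mem x hx => obtain ⟨i, rfl⟩ := hx; exact v.conj_apply_basis i
  | zero => exact map_zero _
  | add x y _ _ hx hy => rw [map_add, hx, hy]
  | smul n x _ hx => rw [map_zsmul, hx]

lemma conj_diagonal (c : ι → ℂ) (x : M) :
    v.conj (v.diagonal c x) = v.diagonal (fun i ↦ starRingEnd ℂ (c i)) (v.conj x) := by
  refine v.ext_elem fun j ↦ ?_
  simp [repr_diagonal]

end Conj

end Module.Basis

end

/-! ### Definiteness of the compact conjugation -/

noncomputable section
open LieAlgebra LieAlgebra.IsKilling LieModule Module Set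

namespace LieAlgebra.IsKilling.IsChevalleySystem

variable {L : Type*} [LieRing L] [LieAlgebra ℂ L] [FiniteDimensional ℂ L]
  [IsKilling ℂ L] {H : LieSubalgebra ℂ L} [H.IsCartanSubalgebra]
  {θ : L →ₗ⁅ℂ⁆ L} {e : Weight ℂ H L → L}
  (C : IsChevalleySystem θ e) (b : (rootSystem H).Base)

lemma conj_lie (x y : L) :
    (C.basis b).conj ⁅x, y⁆ = ⁅(C.basis b).conj x, (C.basis b).conj y⁆ := by
  refine (C.basis b).map_lie_of_forall_basis _ (fun i j ↦ ?_) x y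
  rw [Basis.conj_eq_of_mem_span_int _ (C.lie_basis_mem b i j), Basis.conj_apply_basis,
    Basis.conj_apply_basis]

lemma conj_involution (x : L) : (C.basis b).conj (θ x) = θ ((C.basis b).conj x) := by
  induction x using (C.basis b).induction_smul with
  | zero => simp
  | add x y hx hy => simp [hx, hy]
  | smul a i =>
    rw [map_smul, map_smulₛₗ, map_smulₛₗ, map_smul,
      Basis.conj_eq_of_mem_span_int _ (C.apply_basis_mem b i), Basis.conj_apply_basis]

lemma conj_coroot (α : H.root) : (C.basis b).conj (coroot α.1 : L) = coroot α.1 :=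
  Basis.conj_eq_of_mem_span_int _ (C.coroot_mem_span_int b α)

lemma conj_e (α : Weight ℂ H L) (hα : α.IsNonZero) : (C.basis b).conj (e α) = e α :=
  Basis.conj_eq_of_mem_span_int _ (C.e_mem_span_int b α hα)

/-- The coroots span `H`, are fixed by the conjugation, and have integral, hence real, root values.
-/
lemma exists_coe_eq_conj (h : H) :
    ∃ h' : H, (h' : L) = (C.basis b).conj h ∧
      ∀ α : Weight ℂ H L, α h' = starRingEnd ℂ (α h) := by
  have hh : h ∈ Submodule.span ℂ (range fun i : b.support ↦ coroot i.1.1) := by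
    have h1 := b.span_coroot_support
    have h2 : (rootSystem H).corootSpan ℂ = ⊤ := RootPairing.IsRootSystem.span_coroot_eq_top
    rw [h2] at h1
    have h3 : (range fun i : b.support ↦ coroot i.1.1) = (rootSystem H).coroot '' b.support := by
      ext x
      simp
    rw [h3, h1]
    trivial
  induction hh using Submodule.span_induction with
  | mem h hh =>
    obtain ⟨i, rfl⟩ := hh
    refine ⟨coroot i.1.1, (C.conj_coroot b i.1).symm, fun α ↦ ?_⟩
    rw [apply_coroot_eq_cast, map_intCast]
  | zero => exact ⟨0, by simp, fun α ↦ by simp⟩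
  | add h k _ _ hh hk =>
    obtain ⟨h', h1, h2⟩ := hh
    obtain ⟨k', k1, k2⟩ := hk
    exact ⟨h' + k', by simp [h1, k1], fun α ↦ by
      rw [← Weight.toLinear_apply, ← Weight.toLinear_apply] at *
      simp [h2, k2]⟩
  | smul a h _ hh =>
    obtain ⟨h', h1, h2⟩ := hh
    exact ⟨starRingEnd ℂ a • h', by simp [h1], fun α ↦ by
      simp [h2]⟩

lemma killingForm_cartan (h k : H) :
    killingForm ℂ L h k = ∑ α ∈ H.root, α h * α k := by
  have := LinearMap.congr_fun₂ (restrict_killingForm_eq_sum (K := ℂ) (L := L) (H := H)) h k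
  simpa [mul_comm] using! this

/-- The value is `∑ |α(h)|²`. It vanishes only at `h = 0`, because the simple roots are coordinates
on `H`. -/
lemma exists_killingForm_conj_cartan (h : H) :
    ∃ r : ℝ, killingForm ℂ L h ((C.basis b).conj h) = r ∧ 0 ≤ r ∧ (h ≠ 0 → 0 < r) := by
  obtain ⟨h', h1, h2⟩ := C.exists_coe_eq_conj b h
  refine ⟨∑ α ∈ H.root, Complex.normSq (α h), ?_, ?_, fun hne ↦ ?_⟩
  · rw [← h1, killingForm_cartan]
    push_cast
    exact Finset.sum_congr rfl fun α _ ↦ by rw [h2, Complex.mul_conj]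
  · exact Finset.sum_nonneg fun α _ ↦ Complex.normSq_nonneg _
  · refine lt_of_le_of_ne (Finset.sum_nonneg fun α _ ↦ Complex.normSq_nonneg _) fun h0 ↦ hne ?_
    rw [eq_comm, Finset.sum_eq_zero_iff_of_nonneg fun α _ ↦ Complex.normSq_nonneg _] at h0
    obtain ⟨y, -, hy⟩ := exists_basis_cartan b
    refine y.ext_elem fun j ↦ ?_
    obtain ⟨i, hi⟩ := hy j
    rw [← hi, map_zero, Finsupp.zero_apply]
    rcases i with i | α
    · simp [basisWeight]
    · exact Complex.normSq_eq_zero.1 (h0 α.1 α.2)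

-- The `sl₂` relations give `2κ(e α, e (-α)) = κ(coroot α, coroot α)`, a sum of squares of integers.
include C in
lemma exists_killingForm_e_neg {α : Weight ℂ H L} (hα : α.IsNonZero) :
    ∃ r : ℝ, killingForm ℂ L (e α) (e (-α)) = r ∧ 0 < r := by
  have hne := C.killingForm_e_neg_ne_zero hα
  have h2 := two_mul_killingForm_eq (C.isSl2Triple hα)
  rw [killingForm_cartan] at h2
  have h3 : killingForm ℂ L (e α) (e (-α)) = ((2⁻¹ * ∑ β ∈ H.root,
      ((chainBotCoeff α β - chainTopCoeff α β : ℤ) : ℝ) ^ 2 : ℝ) : ℂ) := by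
    rw [← mul_right_inj' (two_ne_zero (α := ℂ)), h2]
    push_cast
    rw [← mul_assoc, mul_inv_cancel₀ two_ne_zero, one_mul]
    refine Finset.sum_congr rfl fun β _ ↦ ?_
    rw [apply_coroot_eq_cast]
    push_cast
    ring
  refine ⟨_, h3, lt_of_le_of_ne (by positivity) fun h0 ↦ hne ?_⟩
  rw [h3, ← h0, Complex.ofReal_zero]

/-- The Hermitian form attached to the compact conjugation is negative definite. -/
theorem exists_killingForm_conj_involution (x : L) (hx : x ≠ 0) :
    ∃ r : ℝ, killingForm ℂ L x ((C.basis b).conj (θ x)) = -(r : ℂ) ∧ 0 < r := by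
  set v := C.basis b with hv
  let h : H := ∑ i : b.support, v.repr x (.inl i) • coroot i.1.1
  let c : H.root → ℂ := fun α ↦ v.repr x (.inr α)
  let y : L := ∑ α : H.root, c α • e α.1
  have hxy : x = h + y := by
    conv_lhs => rw [← v.sum_repr x, Fintype.sum_sum_type]
    simp [h, y, c, hv, basisVector]
  have hy : v.conj (θ y) = -∑ α : H.root, starRingEnd ℂ (c α) • e (-α.1) := by
    simp only [y, map_sum, map_smul, map_smulₛₗ]
    rw [← Finset.sum_neg_distrib]
    refine Finset.sum_congr rfl fun α _ ↦ ?_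
    have hα := H.isNonZero_coe_root α
    rw [C.apply_e _ hα, map_neg, C.conj_e b _ hα.neg, smul_neg]
  obtain ⟨h', hh', -⟩ := C.exists_coe_eq_conj b h
  obtain ⟨r, hr, hr0, hr1⟩ := C.exists_killingForm_conj_cartan b h
  choose s hs hs0 using fun α : H.root ↦ C.exists_killingForm_e_neg (H.isNonZero_coe_root α)
  -- The map `conj ∘ θ` preserves `H` and sends `e α` to `-e (-α)`. Hence `H` is orthogonal to the
  -- root vectors and these to one another, and the Hermitian form is diagonal on the root part.
  have hc1 : killingForm ℂ L h (v.conj (θ y)) = 0 := by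
    rw [hy, map_neg, map_sum, Finset.sum_eq_zero, neg_zero]
    intro α _
    rw [map_smul, C.killingForm_cartan_e (H.isNonZero_coe_root α).neg h.2, smul_zero]
  have hc2 : killingForm ℂ L y (v.conj h) = 0 := by
    rw [LieModule.traceForm_comm, ← hh']
    simp only [y]
    rw [map_sum, Finset.sum_eq_zero]
    intro α _
    rw [map_smul]
    erw [C.killingForm_cartan_e (H.isNonZero_coe_root α) h'.2]
    rw [smul_zero]
  have hc3 : killingForm ℂ L y (v.conj (θ y)) = -((∑ α, Complex.normSq (c α) * s α : ℝ) : ℂ) := by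
    rw [hy, map_neg]
    congr 1
    simp only [y, map_sum, LinearMap.sum_apply, map_smul, LinearMap.smul_apply]
    push_cast
    refine Finset.sum_congr rfl fun α _ ↦ ?_
    rw [Finset.sum_eq_single α]
    · rw [hs, ← Complex.mul_conj, smul_eq_mul, smul_eq_mul]
      ring
    · intro β _ hβ
      rw [C.killingForm_e_e (H.isNonZero_coe_root _) (H.isNonZero_coe_root _).neg, smul_zero]
      exact fun h ↦ hβ (Subtype.ext (neg_injective h).symm)
    · simp
  have hθh : θ (h : L) = -h := C.apply_cartan _ h.2
  refine ⟨r + ∑ α, Complex.normSq (c α) * s α, ?_, ?_⟩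
  · conv_lhs => rw [hxy]
    rw [map_add, LinearMap.add_apply, map_add, map_add, map_add, map_add, hc1, hc3, hθh,
      map_neg, map_neg, map_neg, hc2, hr]
    push_cast
    ring
  · have hnn : ∀ α, 0 ≤ Complex.normSq (c α) * s α := fun α ↦
      mul_nonneg (Complex.normSq_nonneg _) (hs0 α).le
    by_cases hh0 : h = 0
    · refine add_pos_of_nonneg_of_pos hr0 ?_
      obtain ⟨α, hα⟩ : ∃ α, c α ≠ 0 := by
        by_contra! hall
        exact hx (by rw [hxy, hh0]; simp [y, hall])
      exact Finset.sum_pos' (fun α _ ↦ hnn α)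
        ⟨α, Finset.mem_univ _, mul_pos (Complex.normSq_pos.2 hα) (hs0 α)⟩
    · exact add_pos_of_pos_of_nonneg (hr1 hh0) (Finset.sum_nonneg fun α _ ↦ hnn α)

end LieAlgebra.IsKilling.IsChevalleySystem

end

/-! ### The circle action of the grading and the twisted conjugation -/

noncomputable section
open LieAlgebra LieAlgebra.IsKilling LieModule Module Set

namespace Module.Basis

variable {ι g : Type*} [LieRing g] [LieAlgebra ℂ g] (v : Basis ι ℂ g) (n : ι → ℤ)

/-- The action of `z` on a graded space that is `z ^ (2 * m)` in degree `m`. -/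
def gradingAction (z : ℂ) : g →ₗ[ℂ] g := v.diagonal fun i ↦ z ^ (2 * n i)

lemma gradingAction_mul (z w : ℂ) (x : g) :
    v.gradingAction n (z * w) x = v.gradingAction n z (v.gradingAction n w x) := by
  rw [gradingAction, gradingAction, gradingAction, diagonal_comp]
  congr 2
  ext i
  simp [mul_zpow]

@[simp] lemma gradingAction_one (x : g) : v.gradingAction n 1 x = x := by
  rw [gradingAction, show (fun i ↦ (1 : ℂ) ^ (2 * n i)) = 1 from funext fun i ↦ one_zpow _,
    diagonal_one]

lemma gradingAction_neg (z : ℂ) : v.gradingAction n (-z) = v.gradingAction n z := by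
  rw [gradingAction, gradingAction]
  congr 1
  ext i
  rw [(even_two_mul (n i)).neg_zpow]

lemma conj_gradingAction (z : ℂ) (x : g) :
    v.conj (v.gradingAction n z x) = v.gradingAction n (starRingEnd ℂ z) (v.conj x) := by
  simp only [gradingAction, conj_diagonal, map_zpow₀]

variable {v n} {T : g} (hT : ∀ i, ⁅T, v i⁆ = (n i : ℂ) • v i)
include hT

lemma lie_eq_diagonal (x : g) : ⁅T, x⁆ = v.diagonal (fun i ↦ (n i : ℂ)) x := by
  induction x using v.induction_smul with
  | zero => simp
  | add x y hx hy => simp [hx, hy]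
  | smul a i => simp [hT]

/-- The action depends only on the eigenspaces of `T`, so it can be evaluated on homogeneous vectors
that are not basis vectors, such as brackets and images under θ. -/
lemma gradingAction_of_lie_eq_smul {m : ℤ} {x : g} (hx : ⁅T, x⁆ = (m : ℂ) • x) (z : ℂ) :
    v.gradingAction n z x = z ^ (2 * m) • x := by
  refine v.ext_elem fun i ↦ ?_
  rw [lie_eq_diagonal hT] at hx
  have h := congrArg (fun y ↦ v.repr y i) hx
  simp only [repr_diagonal, map_smul, Finsupp.smul_apply, smul_eq_mul] at h
  rw [gradingAction, repr_diagonal, map_smul, Finsupp.smul_apply, smul_eq_mul]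
  rcases eq_or_ne (v.repr x i) 0 with h0 | h0
  · simp [h0]
  · rw [Int.cast_injective (mul_right_cancel₀ h0 h)]

lemma gradingAction_lie {z : ℂ} (hz : z ≠ 0) (x y : g) :
    v.gradingAction n z ⁅x, y⁆ = ⁅v.gradingAction n z x, v.gradingAction n z y⁆ := by
  refine v.map_lie_of_forall_basis _ (fun i j ↦ ?_) x y
  have h : ⁅T, ⁅v i, v j⁆⁆ = ((n i + n j : ℤ) : ℂ) • ⁅v i, v j⁆ := by
    rw [leibniz_lie, hT, hT, smul_lie, lie_smul]
    push_cast
    rw [add_smul]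
  rw [gradingAction_of_lie_eq_smul hT h, gradingAction, diagonal_apply_basis,
    diagonal_apply_basis, smul_lie, lie_smul, smul_smul, mul_add, zpow_add₀ hz]

omit hT in
lemma gradingAction_I_apply_basis (i : ι) :
    v.gradingAction n Complex.I (v i) = (-1 : ℂ) ^ n i • v i := by
  rw [gradingAction, diagonal_apply_basis, zpow_mul]
  norm_num

/-- At `z = I` the scalar `z^(2m)` is `(-1)^m`, so a fixed vector has nonzero coordinates only in
even degrees. -/
lemma mem_evenPart_iff (x : g) : x ∈ evenPart T ↔ v.gradingAction n Complex.I x = x := by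
  constructor
  · intro h
    suffices evenPart T ≤ LinearMap.eqLocus (v.gradingAction n Complex.I) LinearMap.id from this h
    refine iSup_le fun l y hy ↦ ?_
    rw [gradedPiece, Module.End.mem_eigenspace_iff, LieAlgebra.ad_apply] at hy
    rw [LinearMap.mem_eqLocus, gradingAction_of_lie_eq_smul hT hy, zpow_mul, zpow_mul]
    norm_num
  · intro h
    have hi (i : ι) : v.repr x i • v i ∈ evenPart T := by
      rcases eq_or_ne (v.repr x i) 0 with h0 | h0
      · rw [h0, zero_smul]; exact zero_mem _
      · have h1 := congrArg (fun y ↦ v.repr y i) h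
        rw [gradingAction] at h1
        simp only [repr_diagonal] at h1
        rw [zpow_mul, zpow_ofNat, Complex.I_sq, mul_eq_right₀ h0] at h1
        rcases Int.even_or_odd' (n i) with ⟨l, hl | hl⟩
        · refine Submodule.smul_mem _ _ (Submodule.mem_iSup_of_mem l ?_)
          rw [gradedPiece, Module.End.mem_eigenspace_iff, LieAlgebra.ad_apply, hT, hl]
        · rw [(show Odd (n i) from ⟨l, hl⟩).neg_one_zpow] at h1
          norm_num at h1
    rw [← v.linearCombination_repr x, Finsupp.linearCombination_apply]
    exact sum_mem fun i _ ↦ hi i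

lemma mem_oddPart_iff (x : g) : x ∈ oddPart T ↔ v.gradingAction n Complex.I x = -x := by
  constructor
  · intro h
    suffices oddPart T ≤ LinearMap.eqLocus (v.gradingAction n Complex.I) (-LinearMap.id) from
      this h
    refine iSup_le fun l y hy ↦ ?_
    rw [gradedPiece, Module.End.mem_eigenspace_iff, LieAlgebra.ad_apply] at hy
    rw [LinearMap.mem_eqLocus, gradingAction_of_lie_eq_smul hT (m := 2 * l + 1) (by exact_mod_cast hy),
      zpow_mul, zpow_ofNat, Complex.I_sq,
      (show Odd (2 * l + 1) from ⟨l, rfl⟩).neg_one_zpow, neg_one_smul]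
    rfl
  · intro h
    have hi (i : ι) : v.repr x i • v i ∈ oddPart T := by
      rcases eq_or_ne (v.repr x i) 0 with h0 | h0
      · rw [h0, zero_smul]; exact zero_mem _
      · have h1 := congrArg (fun y ↦ v.repr y i) h
        rw [gradingAction] at h1
        simp only [repr_diagonal, map_neg, Finsupp.neg_apply] at h1
        rw [zpow_mul, zpow_ofNat, Complex.I_sq, ← neg_one_mul (v.repr x i),
          mul_left_inj' h0] at h1
        rcases Int.even_or_odd' (n i) with ⟨l, hl | hl⟩
        · rw [(show Even (n i) from ⟨l, by rw [hl, two_mul]⟩).neg_one_zpow] at h1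
          norm_num at h1
        · refine Submodule.smul_mem _ _ (Submodule.mem_iSup_of_mem l ?_)
          rw [gradedPiece, Module.End.mem_eigenspace_iff, LieAlgebra.ad_apply, hT, hl]
    rw [← v.linearCombination_repr x, Finsupp.linearCombination_apply]
    exact sum_mem fun i _ ↦ hi i

end Module.Basis

namespace LieAlgebra.IsKilling.IsChevalleySystem

variable {g : Type*} [LieRing g] [LieAlgebra ℂ g] [FiniteDimensional ℂ g]
  [IsKilling ℂ g] {H : LieSubalgebra ℂ g} [H.IsCartanSubalgebra]
  {θ : g →ₗ⁅ℂ⁆ g} {e : Weight ℂ H g → g}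
  (C : IsChevalleySystem θ e) (b : (rootSystem H).Base) (n : b.support ⊕ H.root → ℤ)

/-- The composition of the compact conjugation with the Cartan involution `exp (π i ad T)`. -/
def hodgeConj : g →ₛₗ[starRingEnd ℂ] g :=
  ((C.basis b).conj.comp (θ : g →ₗ[ℂ] g)).comp ((C.basis b).gradingAction n Complex.I)

lemma hodgeConj_apply (x : g) : C.hodgeConj b n x =
    (C.basis b).conj (θ ((C.basis b).gradingAction n Complex.I x)) := rfl

lemma hodgeConj_basis_mem (i : b.support ⊕ H.root) :
    C.hodgeConj b n (C.basis b i) ∈ Submodule.span ℤ (range (C.basis b)) := by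
  have h := C.apply_basis_mem b i
  rw [hodgeConj_apply, Basis.gradingAction_I_apply_basis, map_smul, map_smulₛₗ,
    Basis.conj_eq_of_mem_span_int _ h]
  rcases Int.even_or_odd (n i) with hn | hn
  · rw [hn.neg_one_zpow, map_one, one_smul]
    exact h
  · rw [hn.neg_one_zpow, map_neg, map_one, neg_one_smul]
    exact neg_mem h

variable {n} {T : H} (hn : ∀ i, basisWeight b i T = n i)
include hn

lemma lie_basis_eq (i : b.support ⊕ H.root) :
    ⁅(T : g), C.basis b i⁆ = (n i : ℂ) • C.basis b i := by
  rw [coe_basis, C.lie_basisVector, hn]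

lemma gradingAction_cartan (z : ℂ) {h : g} (hh : h ∈ H) :
    (C.basis b).gradingAction n z h = h := by
  have h0 : ⁅(T : g), h⁆ = ((0 : ℤ) : ℂ) • h := by
    rw [Int.cast_zero, zero_smul]
    exact congrArg Subtype.val (trivial_lie_zero H H T ⟨h, hh⟩)
  rw [Basis.gradingAction_of_lie_eq_smul (C.lie_basis_eq b hn) h0]
  simp

/-- As θ negates `T`, it exchanges degrees m and `-m`. -/
lemma involution_gradingAction (z : ℂ) (x : g) :
    θ ((C.basis b).gradingAction n z x) = (C.basis b).gradingAction n z⁻¹ (θ x) := by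
  induction x using (C.basis b).induction_smul with
  | zero => simp
  | add x y hx hy => simp [hx, hy]
  | smul a i =>
    have h : ⁅(T : g), θ (C.basis b i)⁆ = ((-n i : ℤ) : ℂ) • θ (C.basis b i) := by
      conv_lhs => rw [← C.involutive (T : g), C.apply_cartan _ T.2, map_neg, neg_lie]
      rw [← LieHom.map_lie, C.lie_basis_eq b hn, map_smul]
      push_cast
      rw [neg_smul]
    rw [map_smul, map_smul, map_smul, map_smul, Basis.gradingAction_of_lie_eq_smul
      (C.lie_basis_eq b hn) h, Basis.gradingAction, Basis.diagonal_apply_basis, map_smul,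
      mul_neg, inv_zpow', neg_neg]

/-- Two inversions cancel: one from θ reversing degrees, one from conjugating a scalar with `conj z
= z⁻¹`. -/
lemma hodgeConj_gradingAction {z : ℂ} (hz : starRingEnd ℂ z = z⁻¹) (x : g) :
    C.hodgeConj b n ((C.basis b).gradingAction n z x) =
      (C.basis b).gradingAction n z (C.hodgeConj b n x) := by
  rw [hodgeConj_apply, hodgeConj_apply, ← Basis.gradingAction_mul, mul_comm,
    Basis.gradingAction_mul, C.involution_gradingAction b hn, Basis.conj_gradingAction, map_inv₀,
    hz, inv_inv]

/-- The three factors are commuting involutions. For the grading factor this uses that `z` and `-z`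
act alike, so `I² = -1` acts trivially. -/
lemma isLieConjugation_hodgeConj : IsLieConjugation (C.hodgeConj b n) where
  involutive x := by
    have h := C.hodgeConj_gradingAction b hn (z := Complex.I) (by simp) x
    rw [hodgeConj_apply, ← h, hodgeConj_apply, ← Basis.gradingAction_mul, Complex.I_mul_I,
      Basis.gradingAction_neg, Basis.gradingAction_one, ← C.conj_involution, Basis.conj_conj,
      C.involutive]
  map_lie x y := by
    rw [hodgeConj_apply, Basis.gradingAction_lie (C.lie_basis_eq b hn) Complex.I_ne_zero,
      LieHom.map_lie, C.conj_lie]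
    rfl

end LieAlgebra.IsKilling.IsChevalleySystem

end

/-! ### Lattices and the integral form -/

noncomputable section
open Module Set

section Lattice

variable {V N ι : Type*} [AddCommGroup V] [Module ℝ V] [AddCommGroup N] [Module ℝ N]
  (f : N →ₗ[ℝ] V) (w : Basis ι ℝ V) (Z : Submodule ℤ N)

/-- The coordinates of the vectors of a subgroup that is contained in the lattice spanned by a
basis. -/
def latticeCoord (hZ : ∀ x ∈ Z, f x ∈ Submodule.span ℤ (range w)) : Z →ₗ[ℤ] (ι →₀ ℤ) :=
  (w.restrictScalars ℤ).repr.toLinearMap ∘ₗ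
    LinearMap.codRestrict (Submodule.span ℤ (range w)) (f.toAddMonoidHom.toIntLinearMap ∘ₗ Z.subtype)
      fun x ↦ hZ x x.2

lemma linearCombination_latticeCoord (hZ : ∀ x ∈ Z, f x ∈ Submodule.span ℤ (range w)) (x : Z) :
    Finsupp.linearCombination ℤ w (latticeCoord f w Z hZ x) = f x := by
  have h := congrArg Subtype.val ((w.restrictScalars ℤ).linearCombination_repr ⟨f x, hZ x x.2⟩)
  change _ = f x at h
  rw [← h]
  simp only [Finsupp.linearCombination_apply, Finsupp.sum]
  push_cast
  simp only [Basis.restrictScalars_apply]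
  rfl

variable {f Z}

lemma latticeCoord_injective (hf : Function.Injective f)
    (hZ : ∀ x ∈ Z, f x ∈ Submodule.span ℤ (range w)) :
    Function.Injective (latticeCoord f w Z hZ) := fun x y h ↦ by
  have := linearCombination_latticeCoord f w Z hZ x
  rw [h, linearCombination_latticeCoord] at this
  exact Subtype.ext (hf this.symm)

lemma finite_of_le_lattice [Finite ι] (hf : Function.Injective f)
    (hZ : ∀ x ∈ Z, f x ∈ Submodule.span ℤ (range w)) : Module.Finite ℤ Z :=
  Module.Finite.of_injective _ (latticeCoord_injective w hf hZ)

/-- A subgroup of a lattice is a lattice in its real span. -/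
theorem isBaseChange_of_le_lattice (hf : Function.Injective f)
    (hZ : ∀ x ∈ Z, f x ∈ Submodule.span ℤ (range w)) (hspan : Submodule.span ℝ (Z : Set N) = ⊤) :
    IsBaseChange ℝ Z.subtype := by
  let φ : (ℝ ⊗[ℤ] Z) →ₗ[ℝ] N := LinearMap.liftBaseChange ℝ Z.subtype
  have hφ (r : ℝ) (x : Z) : φ (r ⊗ₜ x) = r • (x : N) := LinearMap.liftBaseChange_tmul ..
  have hw : IsBaseChange ℝ (Finsupp.linearCombination ℤ w) := IsBaseChange.of_basis ℤ w
  have hcomp (t : ℝ ⊗[ℤ] Z) :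
      f (φ t) = hw.equiv (LinearMap.lTensor ℝ (latticeCoord f w Z hZ) t) := by
    induction t with
    | zero => simp
    | add s t hs ht => simp only [map_add, hs, ht]
    | tmul r x =>
      rw [LinearMap.lTensor_tmul, IsBaseChange.equiv_tmul, linearCombination_latticeCoord, hφ,
        map_smul]
  -- Flatness of `ℝ` over `ℤ` preserves the inclusion of the subgroup in the full lattice, whose
  -- base change is already known.
  have hinj : Function.Injective φ := fun s t h ↦ by
    refine Module.Flat.lTensor_preserves_injective_linearMap (M := ℝ) _
      (latticeCoord_injective w hf hZ) (hw.equiv.injective ?_)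
    rw [← hcomp, ← hcomp, h]
  have hsurj : Function.Surjective φ := by
    rw [← LinearMap.range_eq_top, eq_top_iff, ← hspan, Submodule.span_le]
    exact fun x hx ↦ ⟨1 ⊗ₜ ⟨x, hx⟩, by rw [hφ, one_smul]⟩
  exact IsBaseChange.of_equiv (LinearEquiv.ofBijective φ ⟨hinj, hsurj⟩) fun x ↦ by
    change φ (1 ⊗ₜ x) = x
    rw [hφ, one_smul]

end Lattice

namespace IsLieConjugation

variable {g ι : Type*} [LieRing g] [LieAlgebra ℂ g] {σ : g →ₛₗ[starRingEnd ℂ] g}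
  (hσ : IsLieConjugation σ) (v : Basis ι ℂ g)
  (hv : ∀ i j, ⁅v i, v j⁆ ∈ Submodule.span ℤ (range v))
  (hσv : ∀ i, σ (v i) ∈ Submodule.span ℤ (range v))

omit hσ in
include hv in
lemma lie_mem_span_int {x y : g} (hx : x ∈ Submodule.span ℤ (range v))
    (hy : y ∈ Submodule.span ℤ (range v)) : ⁅x, y⁆ ∈ Submodule.span ℤ (range v) := by
  induction hx using Submodule.span_induction with
  | mem x hx =>
    obtain ⟨i, rfl⟩ := hx
    induction hy using Submodule.span_induction with
    | mem y hy => obtain ⟨j, rfl⟩ := hy; exact hv i j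
    | zero => simp
    | add y z _ _ hy hz => rw [lie_add]; exact add_mem hy hz
    | smul m y _ hy => rw [lie_smul]; exact zsmul_mem hy m
  | zero => simp
  | add x z _ _ hx hz => rw [add_lie]; exact add_mem hx hz
  | smul m x _ hx => rw [smul_lie]; exact zsmul_mem hx m

/-- The Gaussian integral points of the fixed points of a conjugation. -/
def integralForm : LieSubalgebra ℤ hσ.fixed where
  carrier := {x | ∃ a ∈ Submodule.span ℤ (range v), ∃ b ∈ Submodule.span ℤ (range v),
    (x : g) = a + Complex.I • b}
  add_mem' := by
    rintro x y ⟨a, ha, b, hb, h⟩ ⟨a', ha', b', hb', h'⟩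
    refine ⟨a + a', add_mem ha ha', b + b', add_mem hb hb', ?_⟩
    change (x : g) + y = _
    rw [h, h', smul_add]
    abel
  zero_mem' := ⟨0, zero_mem _, 0, zero_mem _, by simp⟩
  smul_mem' := by
    rintro m x ⟨a, ha, b, hb, h⟩
    refine ⟨m • a, zsmul_mem ha m, m • b, zsmul_mem hb m, ?_⟩
    change ((m • x : hσ.fixed) : g) = _
    rw [show ((m • x : hσ.fixed) : g) = m • (x : g) from rfl, h, smul_add, smul_comm m]
  lie_mem' := by
    rintro x y ⟨a, ha, b, hb, h⟩ ⟨a', ha', b', hb', h'⟩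
    refine ⟨⁅a, a'⁆ - ⁅b, b'⁆, sub_mem (lie_mem_span_int v hv ha ha') (lie_mem_span_int v hv hb hb'),
      ⁅a, b'⁆ + ⁅b, a'⁆, add_mem (lie_mem_span_int v hv ha hb') (lie_mem_span_int v hv hb ha'), ?_⟩
    change ⁅(x : g), (y : g)⁆ = _
    rw [h, h', add_lie, lie_add, lie_add, smul_lie, smul_lie, lie_smul, lie_smul, smul_smul,
      Complex.I_mul_I, smul_add, neg_one_smul]
    abel

include hσv in
theorem isIntegralForm [Finite ι] : IsIntegralForm (hσ.integralForm v hv) := by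
  let w : Basis (Fin 2 × ι) ℝ g := Complex.basisOneI.smulTower v
  have hw0 (i : ι) : w (0, i) = v i := by simp [w, Basis.smulTower_apply]
  have hw1 (i : ι) : w (1, i) = Complex.I • v i := by simp [w, Basis.smulTower_apply]
  have hmem : ∀ x ∈ (hσ.integralForm v hv).toSubmodule,
      hσ.fixed.toSubmodule.subtype x ∈ Submodule.span ℤ (range w) := by
    rintro x ⟨a, ha, b, hb, h⟩
    change (x : g) ∈ _
    rw [h]
    refine add_mem (Submodule.span_mono ?_ ha) ?_
    · rintro _ ⟨i, rfl⟩
      exact ⟨(0, i), hw0 i⟩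
    · clear h
      induction hb using Submodule.span_induction with
      | mem x hx => obtain ⟨i, rfl⟩ := hx; exact Submodule.subset_span ⟨(1, i), hw1 i⟩
      | zero => simp
      | add x z _ _ hx hz => rw [smul_add]; exact add_mem hx hz
      | smul m x _ hx => rw [smul_comm]; exact zsmul_mem hx m
  refine ⟨finite_of_le_lattice w Subtype.val_injective hmem,
    isBaseChange_of_le_lattice w Subtype.val_injective hmem ?_⟩
  have hre (j : Fin 2 × ι) : hσ.re (w j) ∈
      Submodule.span ℝ ((hσ.integralForm v hv).toSubmodule : Set hσ.fixed) := by
    -- The real part of a lattice vector is only half-integral. Doubling gives `v i + σ (v i)` or `I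
    -- (v i - σ (v i))`, both in the Gaussian lattice, and these vectors still span over `ℝ`.
    have h2 : (2 : ℝ) • hσ.re (w j) ∈ (hσ.integralForm v hv).toSubmodule := by
      have h : (((2 : ℝ) • hσ.re (w j) : hσ.fixed) : g) = w j + σ (w j) := by
        change (2 : ℝ) • (hσ.re (w j) : g) = _
        rw [coe_re, ← Complex.coe_smul, smul_smul]
        norm_num
      have hvi (i : ι) : v i ∈ Submodule.span ℤ (range v) := Submodule.subset_span ⟨i, rfl⟩
      obtain ⟨j, i⟩ := j
      fin_cases j
      · refine ⟨v i + σ (v i), add_mem (hvi i) (hσv i), 0, zero_mem _, ?_⟩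
        rw [h]
        simp [hw0]
      · refine ⟨0, zero_mem _, v i - σ (v i), sub_mem (hvi i) (hσv i), ?_⟩
        rw [h]
        simp only [Fin.mk_one, hw1, map_smulₛₗ, Complex.conj_I, smul_sub, zero_add, neg_smul]
        abel
    have := Submodule.smul_mem _ (2⁻¹ : ℝ) (Submodule.subset_span (R := ℝ) h2)
    rwa [smul_smul, inv_mul_cancel₀ two_ne_zero, one_smul] at this
  rw [eq_top_iff]
  intro x _
  rw [← hσ.re_coe x, ← w.linearCombination_repr (x : g), Finsupp.linearCombination_apply,
    Finsupp.sum, map_sum]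
  refine sum_mem fun j _ ↦ ?_
  rw [map_smul]
  exact Submodule.smul_mem _ _ (hre j)

end IsLieConjugation

end

/-! ### Cartan decomposition and Cartan subalgebra of the real form -/

noncomputable section
open LieAlgebra LieAlgebra.IsKilling LieModule Module Set

namespace IsLieConjugation

variable {g : Type*} [LieRing g] [LieAlgebra ℂ g] {σ : g →ₛₗ[starRingEnd ℂ] g}
  (hσ : IsLieConjugation σ)

section Cartan

variable {ψ : g →ₗ[ℂ] g} (hψ : ∀ x y, ψ ⁅x, y⁆ = ⁅ψ x, ψ y⁆)

/-- The points of a real form that are fixed by an automorphism. -/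
def fixedPart : LieSubalgebra ℝ hσ.fixed where
  carrier := {x | ψ x = x}
  add_mem' {x y} hx hy := by
    change ψ ((x : g) + y) = (x : g) + y
    rw [map_add, hx, hy]
  zero_mem' := map_zero ψ
  smul_mem' r x hx := by
    change ψ (r • (x : g)) = r • (x : g)
    rw [← Complex.coe_smul, map_smul, hx]
  lie_mem' {x y} hx hy := by
    change ψ ⁅(x : g), (y : g)⁆ = ⁅(x : g), (y : g)⁆
    rw [hψ, hx, hy]

variable (ψ) in
/-- The points of a real form that are negated by an automorphism. -/
def negPart : Submodule ℝ hσ.fixed where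
  carrier := {x | ψ x = -x}
  add_mem' {x y} hx hy := by
    change ψ ((x : g) + y) = -((x : g) + y)
    rw [map_add, hx, hy, neg_add]
  zero_mem' := by simp
  smul_mem' r x hx := by
    change ψ (r • (x : g)) = -(r • (x : g))
    rw [← Complex.coe_smul, map_smul, hx, smul_neg]

/-- On fixed points of σ with `ψ x = ±x` the Hermitian form reduces to `±κ(x, x)`, so a single
negativity hypothesis yields both signs. -/
theorem isCartanDecomposition [FiniteDimensional ℂ g] (hψψ : ∀ x, ψ (ψ x) = x)
    (hσψ : ∀ x, σ (ψ x) = ψ (σ x))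
    (hneg : ∀ x, x ≠ 0 → ∃ r : ℝ, killingForm ℂ g x (σ (ψ x)) = -(r : ℂ) ∧ 0 < r) :
    IsCartanDecomposition (hσ.fixedPart hψ) (hσ.negPart ψ) where
  isCompl := by
    refine ⟨Submodule.disjoint_def.2 fun x hx hx' ↦ ?_, codisjoint_iff.2 ?_⟩
    · have h : (x : g) = -x := (hx : ψ x = x).symm.trans hx'
      have h2 : (2 : ℂ) • (x : g) = 0 := by
        rw [two_smul]
        nth_rw 1 [h]
        exact neg_add_cancel _
      exact Subtype.ext ((smul_eq_zero.1 h2).resolve_left two_ne_zero)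
    · rw [eq_top_iff]
      intro x _
      have hx' : σ (ψ x) = ψ x := by rw [hσψ, apply_coe]
      let x' : hσ.fixed := ⟨ψ x, hx'⟩
      refine Submodule.mem_sup.2 ⟨(2⁻¹ : ℝ) • (x + x'), Submodule.smul_mem _ _ ?_,
        (2⁻¹ : ℝ) • (x - x'), Submodule.smul_mem _ _ ?_, by module⟩
      · change ψ ((x : g) + ψ x) = (x : g) + ψ x
        rw [map_add, hψψ, add_comm]
      · change ψ ((x : g) - ψ x) = -((x : g) - ψ x)
        rw [map_sub, hψψ, neg_sub]
  lie_k_q x hx y hy := by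
    change ψ ⁅(x : g), (y : g)⁆ = -⁅(x : g), (y : g)⁆
    rw [hψ, (hx : ψ x = x), (hy : ψ y = -y), lie_neg]
  lie_q_q x hx y hy := by
    change ψ ⁅(x : g), (y : g)⁆ = ⁅(x : g), (y : g)⁆
    rw [hψ, (hx : ψ x = -x), (hy : ψ y = -y), lie_neg, neg_lie, neg_neg]
  neg_def x hx hx0 := by
    obtain ⟨r, hr, hr0⟩ := hneg x fun h ↦ hx0 (Subtype.ext h)
    rw [(hx : ψ x = x), apply_coe, ← ofReal_killingForm, ← Complex.ofReal_neg,
      Complex.ofReal_inj] at hr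
    rw [hr]
    exact neg_lt_zero.2 hr0
  pos_def x hx hx0 := by
    obtain ⟨r, hr, hr0⟩ := hneg x fun h ↦ hx0 (Subtype.ext h)
    rw [(hx : ψ x = -x), map_neg, apply_coe, map_neg, ← ofReal_killingForm, neg_inj,
      Complex.ofReal_inj] at hr
    rwa [hr]

end Cartan

section Subalgebra

variable (H : LieSubalgebra ℂ g)

/-- The points of a real form that lie in a complex subalgebra. -/
def realPart : LieSubalgebra ℝ hσ.fixed where
  carrier := {x | (x : g) ∈ H}
  add_mem' hx hy := H.add_mem hx hy
  zero_mem' := H.zero_mem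
  smul_mem' r x hx := by
    change r • (x : g) ∈ H
    rw [← Complex.coe_smul]
    exact H.smul_mem _ hx
  lie_mem' hx hy := H.lie_mem hx hy

lemma mem_realPart {x : hσ.fixed} : x ∈ hσ.realPart H ↔ (x : g) ∈ H := Iff.rfl

variable {H} (hH : ∀ x ∈ H, σ x ∈ H)
include hH

lemma complexSpan_realPart : complexSpan (hσ.realPart H).toSubmodule = H.toSubmodule :=
  hσ.complexSpan_eq _ _ hH fun _ ↦ Iff.rfl

/-- An element normalising the real points of `H` also normalises their complex span, which is `H`,
and `H` is its own normaliser. -/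
theorem isCartanSubalgebra_realPart [H.IsCartanSubalgebra] [IsLieAbelian H] :
    (hσ.realPart H).IsCartanSubalgebra where
  nilpotent := by
    have : IsLieAbelian (hσ.realPart H) := ⟨fun x y ↦ Subtype.ext <| Subtype.ext <| by
      have h := congrArg Subtype.val (trivial_lie_zero H H ⟨x.1.1, x.2⟩ ⟨y.1.1, y.2⟩)
      exact h⟩
    infer_instance
  self_normalizing := by
    refine le_antisymm (fun x hx ↦ ?_) (LieSubalgebra.le_normalizer _)
    rw [LieSubalgebra.mem_normalizer_iff] at hx
    rw [mem_realPart, ← LieSubalgebra.IsCartanSubalgebra.self_normalizing (H := H),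
      LieSubalgebra.mem_normalizer_iff]
    intro y hy
    have key : ∀ z ∈ H, ⁅(x : g), (hσ.re z : g)⁆ ∈ H := fun z hz ↦
      hx (hσ.re z) (by
        rw [mem_realPart, coe_re]
        exact H.smul_mem _ (H.add_mem hz (hH z hz)))
    rw [← hσ.re_add_I_smul_re y, lie_add, lie_smul]
    exact H.add_mem (key y hy) (H.smul_mem _ (key _ (H.smul_mem _ hy)))

end Subalgebra

end IsLieConjugation

end

/-! ### Exponentials of diagonal operators -/

noncomputable section
open LieAlgebra LieAlgebra.IsKilling LieModule Module Set

section Exp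

variable {M : Type*} [AddCommGroup M] [Module ℝ M]

theorem IsExp.unique [FiniteDimensional ℝ M] {A E E' : Module.End ℝ M} (h : IsExp A E)
    (h' : IsExp A E') : E = E' := by
  let _ : TopologicalSpace (Module.End ℝ M) := moduleTopology ℝ (Module.End ℝ M)
  have : IsModuleTopology ℝ (Module.End ℝ M) := ⟨rfl⟩
  have : T2Space (Module.End ℝ M) := by
    let f := (Module.finBasis ℝ (Module.End ℝ M)).equivFun
    exact T2Space.of_injective_continuous f.injective
      (IsModuleTopology.continuous_of_linearMap f.toLinearMap)
  exact HasSum.unique h h'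

/-- The scalar exponential series converges coordinatewise in `ι → ℂ`, and a real linear map out of
this finite-dimensional space is continuous, so no norm on the endomorphisms is needed. -/
theorem isExp_of_linearMap {ι : Type*} [Fintype ι] (D : (ι → ℂ) →ₗ[ℝ] Module.End ℝ M)
    (c : ι → ℂ) (A : Module.End ℝ M) (h : ∀ n : ℕ, D (c ^ n) = A ^ n) :
    IsExp A (D fun i ↦ Complex.exp (c i)) := by
  let _ : TopologicalSpace (Module.End ℝ M) := moduleTopology ℝ (Module.End ℝ M)
  have : IsModuleTopology ℝ (Module.End ℝ M) := ⟨rfl⟩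
  have : IsTopologicalAddGroup (Module.End ℝ M) := IsModuleTopology.topologicalAddGroup ℝ _
  have hD : Continuous D := D.continuous_of_finiteDimensional
  have h1 : HasSum (fun n : ℕ ↦ ((n.factorial : ℝ)⁻¹) • c ^ n) (fun i ↦ Complex.exp (c i)) := by
    rw [Pi.hasSum]
    intro i
    have h2 := NormedSpace.exp_series_hasSum_exp' (𝕂 := ℝ) (c i)
    rw [← Complex.exp_eq_exp_ℂ] at h2
    exact h2
  have h3 := h1.map D hD
  unfold IsExp
  convert h3 using 2 with n
  simp [h]

end Exp

namespace IsLieConjugation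

variable {g : Type*} [LieRing g] [LieAlgebra ℂ g] {σ : g →ₛₗ[starRingEnd ℂ] g}
  (hσ : IsLieConjugation σ)

/-- The compression of a complex endomorphism to a real form. -/
def compress : (g →ₗ[ℂ] g) →ₗ[ℝ] Module.End ℝ hσ.fixed where
  toFun f := hσ.re ∘ₗ f.restrictScalars ℝ ∘ₗ hσ.fixed.toSubmodule.subtype
  map_add' f f' := by
    ext1 x
    exact map_add hσ.re _ _
  map_smul' r f := by
    ext1 x
    exact map_smul hσ.re _ _

lemma compress_apply (f : g →ₗ[ℂ] g) (x : hσ.fixed) : hσ.compress f x = hσ.re (f x) := rfl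

/-- For operators commuting with σ, compression is restriction. Compressing arbitrary operators
makes the construction linear on all diagonal coefficients, also those not preserving the real form,
which is what allows the exponential series to be pushed through it. -/
lemma coe_compress {f : g →ₗ[ℂ] g} (hf : ∀ x, σ (f x) = f (σ x)) (x : hσ.fixed) :
    (hσ.compress f x : g) = f x := by
  have h : σ (f x) = f x := by rw [hf, apply_coe]
  exact congrArg Subtype.val (hσ.re_coe ⟨f x, h⟩)

variable {ι : Type*} (v : Basis ι ℂ g)

/-- The compressions to a real form of the operators that are diagonal in a basis. -/
def compressDiagonal : (ι → ℂ) →ₗ[ℝ] Module.End ℝ hσ.fixed where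
  toFun c := hσ.compress (v.diagonal c)
  map_add' c d := by
    rw [← map_add]
    congr 1
    refine v.ext fun i ↦ ?_
    simp [add_smul]
  map_smul' r c := by
    rw [← map_smul]
    congr 1
    refine v.ext fun i ↦ ?_
    simp [mul_smul]

lemma compressDiagonal_apply (c : ι → ℂ) :
    hσ.compressDiagonal v c = hσ.compress (v.diagonal c) := rfl

theorem isExp_ad [Fintype ι] (h : hσ.fixed) (c : ι → ℂ) (hc : ∀ i, ⁅(h : g), v i⁆ = c i • v i) :
    IsExp (LieAlgebra.ad ℝ hσ.fixed h) (hσ.compressDiagonal v fun i ↦ Complex.exp (c i)) := by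
  have hd (x : g) : v.diagonal c x = ⁅(h : g), x⁆ := by
    induction x using v.induction_smul with
    | zero => simp
    | add x y hx hy => simp [hx, hy]
    | smul a i => simp [hc]
  refine isExp_of_linearMap _ c _ fun n ↦ ?_
  ext1 x
  have key : (((LieAlgebra.ad ℝ hσ.fixed h) ^ n) x : g) = v.diagonal (c ^ n) x := by
    induction n with
    | zero => simp
    | succ n ih =>
      rw [pow_succ', pow_succ', ← v.diagonal_comp, ← ih, hd]
      rfl
  rw [compressDiagonal_apply, compress_apply, ← key, re_coe]

end IsLieConjugation

end

/-! ### The compact torus and the circle in the adjoint group -/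

noncomputable section
open LieAlgebra LieAlgebra.IsKilling LieModule Module Set

namespace LieAlgebra.IsKilling.IsChevalleySystem

variable {g : Type*} [LieRing g] [LieAlgebra ℂ g] [FiniteDimensional ℂ g]
  [IsKilling ℂ g] {H : LieSubalgebra ℂ g} [H.IsCartanSubalgebra]
  {θ : g →ₗ⁅ℂ⁆ g} {e : Weight ℂ H g → g}
  (C : IsChevalleySystem θ e) (b : (rootSystem H).Base) {n : b.support ⊕ H.root → ℤ}

lemma eq_of_basisWeight_eq {h k : H} (hk : ∀ i, basisWeight b i h = basisWeight b i k) : h = k := by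
  obtain ⟨y, -, hy⟩ := exists_basis_cartan b
  refine y.ext_elem fun j ↦ ?_
  obtain ⟨i, hi⟩ := hy j
  rw [← hi, ← hi, hk]

lemma exists_coe_eq_conj_basisWeight (h : H) :
    ∃ h' : H, (h' : g) = (C.basis b).conj h ∧
      ∀ i, basisWeight b i h' = starRingEnd ℂ (basisWeight b i h) := by
  obtain ⟨h', h1, h2⟩ := C.exists_coe_eq_conj b h
  refine ⟨h', h1, ?_⟩
  rintro (i | α)
  · simp [basisWeight]
  · exact h2 α

variable {T : H} (hn : ∀ i, basisWeight b i T = n i)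
include hn

lemma hodgeConj_cartan {h : g} (hh : h ∈ H) : C.hodgeConj b n h = -(C.basis b).conj h := by
  rw [hodgeConj_apply, C.gradingAction_cartan b hn _ hh, C.apply_cartan _ hh, map_neg]

lemma hodgeConj_mem_cartan (h : g) (hh : h ∈ H) : C.hodgeConj b n h ∈ H := by
  obtain ⟨h', h1, -⟩ := C.exists_coe_eq_conj b ⟨h, hh⟩
  rw [C.hodgeConj_cartan b hn hh, ← h1]
  exact H.neg_mem h'.2

/-- On `H` the twisted conjugation is minus the coordinate conjugation, which conjugates the values
of the roots. -/
lemma hodgeConj_eq_self_iff (h : H) :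
    C.hodgeConj b n h = h ↔ ∀ i, (basisWeight b i h).re = 0 := by
  obtain ⟨h', h1, h2⟩ := C.exists_coe_eq_conj_basisWeight b h
  rw [C.hodgeConj_cartan b hn h.2, ← h1]
  have key : -(h' : g) = h ↔ -h' = h := by
    rw [← Subtype.coe_inj]
    rfl
  rw [key]
  constructor
  · intro hh i
    have h3 := h2 i
    rw [neg_eq_iff_eq_neg.1 hh, map_neg] at h3
    have h4 := congrArg Complex.re h3
    rw [Complex.neg_re, Complex.conj_re] at h4
    linarith
  · intro hh
    refine eq_of_basisWeight_eq b fun i ↦ ?_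
    rw [map_neg, h2]
    apply Complex.ext <;> simp [hh]

/-- Elements of the real Cartan subalgebra are purely imaginary combinations of the fundamental
coweights. Their exponentials have eigenvalues that are Laurent monomials in points of the circle,
so the torus is the image of a compact product of circles under a continuous map. -/
theorem isCompactTorus :
    IsCompactTorus ((C.isLieConjugation_hodgeConj b hn).realPart H) := by
  have hσ := C.isLieConjugation_hodgeConj b hn
  obtain ⟨y, hy, hyr⟩ := exists_basis_cartan b
  choose m hm using hy
  let P : (b.support → Circle) → (b.support ⊕ H.root → ℂ) := fun z i ↦ ∏ j, (z j : ℂ) ^ m i j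
  have hP : Continuous P := by
    refine continuous_pi fun i ↦ continuous_finsetProd _ fun j _ ↦ ?_
    exact (Continuous.subtype_val (continuous_apply j)).zpow₀ _ fun z ↦
      Or.inl (Circle.coe_ne_zero _)
  let D := hσ.compressDiagonal (C.basis b)
  have hexp (s : b.support → ℝ) (h : H) (hs : h = ∑ j, (s j * Complex.I : ℂ) • y j) (i) :
      Complex.exp (basisWeight b i h) = P (fun j ↦ Circle.exp (s j)) i := by
    rw [hs, map_sum, Complex.exp_sum]
    refine Finset.prod_congr rfl fun j _ ↦ ?_
    rw [map_smul, hm, smul_eq_mul, mul_comm, Complex.exp_int_mul, Circle.coe_exp]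
  have hE (x : hσ.fixed) (hx : (x : g) ∈ H) :
      IsExp (LieAlgebra.ad ℝ hσ.fixed x) (D fun i ↦ Complex.exp (basisWeight b i ⟨x, hx⟩)) :=
    hσ.isExp_ad (C.basis b) x _ fun i ↦ by
      rw [coe_basis]
      exact C.lie_basisVector b ⟨x, hx⟩ i
  have himage : expAd (hσ.realPart H) = range (D ∘ P) := by
    ext E
    constructor
    · rintro ⟨x, hx, hxE⟩
      rw [hxE.unique (hE x hx)]
      have hre := (C.hodgeConj_eq_self_iff b hn ⟨x, hx⟩).1 x.2
      refine ⟨fun j ↦ Circle.exp (y.repr ⟨x, hx⟩ j).im, congrArg D (funext fun i ↦ ?_)⟩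
      refine (hexp _ _ ?_ i).symm
      conv_lhs => rw [← y.sum_repr ⟨x, hx⟩]
      refine Finset.sum_congr rfl fun j _ ↦ ?_
      congr 1
      obtain ⟨i, hi⟩ := hyr j
      rw [← hi]
      apply Complex.ext <;> simp [hre i]
    · rintro ⟨z, rfl⟩
      choose s hs using fun j ↦ Circle.exp_surjective (z j)
      let h : H := ∑ j, (s j * Complex.I : ℂ) • y j
      have hh : C.hodgeConj b n h = h := by
        rw [C.hodgeConj_eq_self_iff b hn]
        intro i
        simp only [h, map_sum, map_smul, hm, smul_eq_mul, Complex.re_sum]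
        exact Finset.sum_eq_zero fun j _ ↦ by simp
      refine ⟨⟨h, hh⟩, h.2, ?_⟩
      convert hE ⟨h, hh⟩ h.2 using 1
      refine congrArg D (funext fun i ↦ ?_)
      rw [hexp s h rfl, funext hs]
  unfold IsCompactTorus
  let _ : TopologicalSpace (Module.End ℝ hσ.fixed) := moduleTopology ℝ (Module.End ℝ hσ.fixed)
  have : IsModuleTopology ℝ (Module.End ℝ hσ.fixed) := ⟨rfl⟩
  have : IsTopologicalAddGroup (Module.End ℝ hσ.fixed) := IsModuleTopology.topologicalAddGroup ℝ _
  change IsCompact (expAd (hσ.realPart H))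
  rw [himage]
  exact isCompact_range (D.continuous_of_finiteDimensional.comp hP)

lemma hodgeConj_gradingAction_circle (z : Circle) (x : g) :
    C.hodgeConj b n ((C.basis b).gradingAction n z x) =
      (C.basis b).gradingAction n z (C.hodgeConj b n x) :=
  C.hodgeConj_gradingAction b hn (by rw [← Circle.coe_inv_eq_conj, Circle.coe_inv]) x

/-- The action of the circle on the real form through the grading. -/
def circleHom : Circle →* ((C.isLieConjugation_hodgeConj b hn).fixed ≃ₗ[ℝ]
    (C.isLieConjugation_hodgeConj b hn).fixed) :=
  (LinearMap.GeneralLinearGroup.generalLinearEquiv ℝ _).toMonoidHom.comp <|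
    MonoidHom.toHomUnits
      { toFun z := (C.isLieConjugation_hodgeConj b hn).compress ((C.basis b).gradingAction n z)
        map_one' := LinearMap.ext fun x ↦ Subtype.ext <| by
          rw [IsLieConjugation.coe_compress _ (C.hodgeConj_gradingAction_circle b hn 1),
            Circle.coe_one, Basis.gradingAction_one]
          rfl
        map_mul' z w := LinearMap.ext fun x ↦ Subtype.ext <| by
          rw [IsLieConjugation.coe_compress _ (C.hodgeConj_gradingAction_circle b hn (z * w)),
            Module.End.mul_apply,
            IsLieConjugation.coe_compress _ (C.hodgeConj_gradingAction_circle b hn z),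
            IsLieConjugation.coe_compress _ (C.hodgeConj_gradingAction_circle b hn w),
            Circle.coe_mul, Basis.gradingAction_mul] }

lemma coe_circleHom_apply (z : Circle) (x : (C.isLieConjugation_hodgeConj b hn).fixed) :
    (C.circleHom b hn z x : g) = (C.basis b).gradingAction n z x :=
  IsLieConjugation.coe_compress _ (C.hodgeConj_gradingAction_circle b hn z) x

/-- The infinitesimal generator of the circle action. -/
def generator : (C.isLieConjugation_hodgeConj b hn).fixed :=
  ⟨(4 * (Real.pi : ℂ) * Complex.I) • (T : g), by
    rw [IsLieConjugation.mem_fixed]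
    have h := (C.hodgeConj_eq_self_iff b hn ((4 * (Real.pi : ℂ) * Complex.I) • T)).2 fun i ↦ by
      rw [map_smul, hn]
      simp
    exact h⟩

lemma generator_mem : C.generator b hn ∈ (C.isLieConjugation_hodgeConj b hn).realPart H :=
  H.smul_mem _ T.2

theorem isExp_circleHom (s : ℝ) :
    IsExp (LieAlgebra.ad ℝ _ (s • C.generator b hn))
      (C.circleHom b hn (Circle.exp (2 * Real.pi * s)) : _ →ₗ[ℝ] _) := by
  -- These are the eigenvalues of `s · 4πi T`, arranged as an integer times `2πs i` so that their
  -- exponentials are the powers `z^(2 n i)`.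
  let c : b.support ⊕ H.root → ℂ :=
    fun i ↦ ((2 * n i : ℤ) : ℂ) * ((2 * Real.pi * s : ℝ) * Complex.I)
  have hc (i) : ⁅((s • C.generator b hn : (C.isLieConjugation_hodgeConj b hn).fixed) : g),
      C.basis b i⁆ = c i • C.basis b i := by
    change ⁅s • (4 * (Real.pi : ℂ) * Complex.I) • (T : g), C.basis b i⁆ = _
    rw [← Complex.coe_smul, smul_smul, smul_lie, C.lie_basis_eq b hn, smul_smul]
    congr 1
    simp only [c]
    push_cast
    ring
  have hexp : (fun i ↦ Complex.exp (c i)) =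
      fun i ↦ (Circle.exp (2 * Real.pi * s) : ℂ) ^ (2 * n i) :=
    funext fun i ↦ by rw [Complex.exp_int_mul, Circle.coe_exp]
  have h := (C.isLieConjugation_hodgeConj b hn).isExp_ad (C.basis b) _ c hc
  rw [hexp] at h
  exact h

lemma circleHom_mem_adjointGroup (z : Circle) : C.circleHom b hn z ∈ adjointGroup _ := by
  obtain ⟨u, rfl⟩ := Circle.exp_surjective z
  refine Subgroup.subset_closure ⟨(u / (2 * Real.pi)) • C.generator b hn, ?_⟩
  have h := C.isExp_circleHom b hn (u / (2 * Real.pi))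
  rwa [mul_div_cancel₀ u (by positivity : (2 * Real.pi) ≠ 0)] at h

end LieAlgebra.IsKilling.IsChevalleySystem

end

/-! ### The Hodge structure: algebraicity and determinant -/

noncomputable section
open LieAlgebra LieAlgebra.IsKilling LieModule Module Set

lemma Circle.exists_polynomial_zpow (k : ℤ) :
    ∃ P Q : MvPolynomial (Fin 2) ℝ, ∀ z : Circle,
      ((z : ℂ) ^ k).re = MvPolynomial.eval ![(z : ℂ).re, (z : ℂ).im] P ∧
      ((z : ℂ) ^ k).im = MvPolynomial.eval ![(z : ℂ).re, (z : ℂ).im] Q := by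
  have hnat (k : ℕ) : ∃ P Q : MvPolynomial (Fin 2) ℝ, ∀ z : Circle,
      ((z : ℂ) ^ k).re = MvPolynomial.eval ![(z : ℂ).re, (z : ℂ).im] P ∧
      ((z : ℂ) ^ k).im = MvPolynomial.eval ![(z : ℂ).re, (z : ℂ).im] Q := by
    induction k with
    | zero => exact ⟨1, 0, fun z ↦ by simp⟩
    | succ k ih =>
      obtain ⟨P, Q, h⟩ := ih
      refine ⟨P * MvPolynomial.X 0 - Q * MvPolynomial.X 1,
        P * MvPolynomial.X 1 + Q * MvPolynomial.X 0, fun z ↦ ?_⟩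
      rw [pow_succ, Complex.mul_re, Complex.mul_im, (h z).1, (h z).2]
      simp
  obtain ⟨m, rfl | rfl⟩ := k.eq_nat_or_neg
  · simpa only [zpow_natCast] using hnat m
  -- On the unit circle the inverse is the conjugate, so negative powers stay polynomial.
  · obtain ⟨P, Q, h⟩ := hnat m
    refine ⟨P, -Q, fun z ↦ ?_⟩
    rw [zpow_neg, zpow_natCast, ← inv_pow, ← Circle.coe_inv, Circle.coe_inv_eq_conj, ← map_pow,
      Complex.conj_re, Complex.conj_im, (h z).1, (h z).2, map_neg]
    exact ⟨rfl, rfl⟩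

/-- The Hodge structure of weight zero on a rational form of a real Lie algebra that is given by
an action of the circle. -/
def IsIntegralForm.hodgeStructure {M : Type*} [LieRing M] [LieAlgebra ℝ M]
    {MZ : LieSubalgebra ℤ M} (hZ : IsIntegralForm MZ) (ρ : Circle →* (M ≃ₗ[ℝ] M))
    (hdet : ∀ z, LinearEquiv.det (ρ z) = 1)
    (halg : ∀ (x : M) (f : M →ₗ[ℝ] ℝ), ∃ P : MvPolynomial (Fin 2) ℝ, ∀ z : Circle,
      f (ρ z x) = MvPolynomial.eval ![(z : ℂ).re, (z : ℂ).im] P)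
    (hneg : ∀ z : Circle, (z : ℂ) = -1 → ∀ x, ρ z x = x) : HodgeStructure (ℚ ⊗[ℤ] MZ) 0 where
  finite := have := hZ.finite; inferInstance
  φ :=
    { toFun z := ⟨(hZ.realEquiv.trans (ρ z)).trans hZ.realEquiv.symm, by
        rw [← hdet z]
        exact LinearEquiv.det_conj (ρ z) hZ.realEquiv.symm⟩
      map_one' := Subtype.ext <| LinearEquiv.ext fun x ↦ by
        change hZ.realEquiv.symm (ρ 1 (hZ.realEquiv x)) = x
        rw [map_one]
        exact hZ.realEquiv.symm_apply_apply x
      map_mul' z w := Subtype.ext <| LinearEquiv.ext fun x ↦ by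
        change hZ.realEquiv.symm (ρ (z * w) (hZ.realEquiv x)) =
          hZ.realEquiv.symm (ρ z (hZ.realEquiv (hZ.realEquiv.symm (ρ w (hZ.realEquiv x)))))
        rw [LinearEquiv.apply_symm_apply, map_mul]
        rfl }
  algebraic v f := halg (hZ.realEquiv v) (f ∘ₗ hZ.realEquiv.symm.toLinearMap)
  weight z hz v := by
    change hZ.realEquiv.symm (ρ z (hZ.realEquiv v)) = _
    rw [hneg z hz, LinearEquiv.symm_apply_apply, zpow_zero, one_smul]

lemma IsIntegralForm.realEquiv_hodgeStructure {M : Type*} [LieRing M] [LieAlgebra ℝ M]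
    {MZ : LieSubalgebra ℤ M} (hZ : IsIntegralForm MZ) (ρ : Circle →* (M ≃ₗ[ℝ] M))
    (hdet halg hneg) (z : Circle) (v : ℝ ⊗[ℚ] (ℚ ⊗[ℤ] MZ)) :
    hZ.realEquiv ((hZ.hodgeStructure ρ hdet halg hneg).φ z v) = ρ z (hZ.realEquiv v) :=
  hZ.realEquiv.apply_symm_apply _

namespace LieAlgebra.IsKilling.IsChevalleySystem

variable {g : Type*} [LieRing g] [LieAlgebra ℂ g] [FiniteDimensional ℂ g]
  [IsKilling ℂ g] {H : LieSubalgebra ℂ g} [H.IsCartanSubalgebra]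
  {θ : g →ₗ⁅ℂ⁆ g} {e : Weight ℂ H g → g}
  (C : IsChevalleySystem θ e) (b : (rootSystem H).Base) {n : b.support ⊕ H.root → ℤ}
  {T : H} (hn : ∀ i, basisWeight b i T = n i)
include hn

lemma hodgeConj_involution (x : g) : C.hodgeConj b n (θ x) = θ (C.hodgeConj b n x) := by
  rw [hodgeConj_apply, hodgeConj_apply, C.conj_involution, C.involution_gradingAction b hn,
    Complex.inv_I, Basis.gradingAction_neg]

/-- The involution θ preserves the real form and conjugates the action of `z` to that of `z⁻¹`, so
both have the same determinant. -/
theorem det_circleHom (z : Circle) : LinearEquiv.det (C.circleHom b hn z) = 1 := by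
  let d : Circle →* ℝˣ := LinearEquiv.det.comp (C.circleHom b hn)
  let ϑ := (C.isLieConjugation_hodgeConj b hn).compress (θ : g →ₗ[ℂ] g)
  have hϑ (x) : (ϑ x : g) = θ x :=
    IsLieConjugation.coe_compress _ (C.hodgeConj_involution b hn) x
  have hϑϑ : ϑ * ϑ = 1 := LinearMap.ext fun x ↦ Subtype.ext <| by
    rw [Module.End.mul_apply, hϑ, hϑ, C.involutive]
    rfl
  have hinv (z : Circle) : (C.circleHom b hn z⁻¹).toLinearMap =
      ϑ * (C.circleHom b hn z).toLinearMap * ϑ := LinearMap.ext fun x ↦ Subtype.ext <| by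
    rw [Module.End.mul_apply, Module.End.mul_apply, hϑ, LinearEquiv.coe_coe, LinearEquiv.coe_coe,
      coe_circleHom_apply, coe_circleHom_apply, hϑ, C.involution_gradingAction b hn, C.involutive,
      Circle.coe_inv]
  have hd (z : Circle) : d z⁻¹ = d z := Units.ext <| by
    rw [MonoidHom.comp_apply, MonoidHom.comp_apply, LinearEquiv.coe_det, LinearEquiv.coe_det,
      hinv, map_mul, map_mul, mul_right_comm, ← map_mul, hϑϑ, map_one, one_mul]
  obtain ⟨u, rfl⟩ := Circle.exp_surjective z
  change d (Circle.exp u) = 1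
  -- Equality of determinants at `w` and `w⁻¹` only says that the square is 1. Writing `z = w²`
  -- removes the sign.
  rw [← add_halves u, Circle.exp_add, map_mul]
  nth_rw 1 [← hd]
  rw [← map_mul, inv_mul_cancel, map_one]

lemma exists_polynomial_circleHom (x : (C.isLieConjugation_hodgeConj b hn).fixed)
    (f : (C.isLieConjugation_hodgeConj b hn).fixed →ₗ[ℝ] ℝ) :
    ∃ P : MvPolynomial (Fin 2) ℝ, ∀ z : Circle,
      f (C.circleHom b hn z x) = MvPolynomial.eval ![(z : ℂ).re, (z : ℂ).im] P := by
  choose P Q hPQ using fun i ↦ Circle.exists_polynomial_zpow (2 * n i)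
  -- Extending the functional to `g` by the real part makes it applicable to the single terms of the
  -- basis expansion, which need not lie in the real form.
  let F : g →ₗ[ℝ] ℝ := f ∘ₗ (C.isLieConjugation_hodgeConj b hn).re
  have hF (w : ℂ) (y : g) : F (w • y) = w.re * F y + w.im * F (Complex.I • y) := by
    have h : w • y = w.re • y + w.im • Complex.I • y := by
      rw [← Complex.coe_smul, ← Complex.coe_smul, smul_smul, ← add_smul, Complex.re_add_im]
    rw [h, map_add, F.map_smul, F.map_smul, smul_eq_mul, smul_eq_mul]
  refine ⟨∑ i, (P i * MvPolynomial.C (F ((C.basis b).repr x i • C.basis b i)) +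
    Q i * MvPolynomial.C (F (Complex.I • (C.basis b).repr x i • C.basis b i))), fun z ↦ ?_⟩
  have h1 : f (C.circleHom b hn z x) =
      ∑ i, F ((z : ℂ) ^ (2 * n i) • (C.basis b).repr x i • C.basis b i) := by
    change F ((C.basis b).gradingAction n (z : ℂ) x) = _
    conv_lhs => rw [← (C.basis b).sum_repr (x : g)]
    rw [map_sum, map_sum]
    refine Finset.sum_congr rfl fun i _ ↦ ?_
    rw [map_smul, Basis.gradingAction, Basis.diagonal_apply_basis, smul_comm]
  rw [h1, map_sum]
  refine Finset.sum_congr rfl fun i _ ↦ ?_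
  rw [hF, (hPQ i z).1, (hPQ i z).2]
  simp

lemma circleHom_apply_of_coe_eq_neg_one {z : Circle} (hz : (z : ℂ) = -1)
    (x : (C.isLieConjugation_hodgeConj b hn).fixed) : C.circleHom b hn z x = x :=
  Subtype.ext <| by
    rw [coe_circleHom_apply, hz, Basis.gradingAction_neg, Basis.gradingAction_one]

end LieAlgebra.IsKilling.IsChevalleySystem

end

/-! ### Transport to the rational Lie algebra and polarization -/

noncomputable section
open LieAlgebra Module Set

/-- A real Lie algebra is the base change of the rational Lie algebra of an integral form. -/
def IsIntegralForm.lieEquiv {M : Type*} [LieRing M] [LieAlgebra ℝ M] {MZ : LieSubalgebra ℤ M}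
    (hZ : IsIntegralForm MZ) : (ℝ ⊗[ℚ] (ℚ ⊗[ℤ] MZ)) ≃ₗ⁅ℝ⁆ M :=
  lieEquivOfBaseChange hZ.realEquiv <| map_lie_of_forall_tmul
    (hZ.realEquiv.toLinearMap.toAddMonoidHom.comp (TensorProduct.mk ℚ ℝ _ 1).toAddMonoidHom)
    fun c d x y ↦ by
      change hZ.realEquiv (1 ⊗ₜ ((c * d) ⊗ₜ ⁅x, y⁆)) =
        ⁅hZ.realEquiv (1 ⊗ₜ (c ⊗ₜ x)), hZ.realEquiv (1 ⊗ₜ (d ⊗ₜ y))⁆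
      rw [realEquiv_tmul, realEquiv_tmul, realEquiv_tmul, smul_lie, lie_smul, smul_smul]
      push_cast
      rw [one_mul, one_mul, one_mul]

namespace HodgeStructure

variable {V : Type*} [AddCommGroup V] [Module ℚ V]

lemma formC_neg (Q : LinearMap.BilinForm ℚ V) : formC (-Q) = -formC Q := by
  have h1 : LinearMap.BilinForm.baseChange ℝ (-Q) = -LinearMap.BilinForm.baseChange ℝ Q := by
    ext x y
    simp
  have h2 (B : LinearMap.BilinForm ℝ (ℝ ⊗[ℚ] V)) :
      LinearMap.BilinForm.baseChange ℂ (-B) = -LinearMap.BilinForm.baseChange ℂ B := by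
    ext x y
    simp
  rw [formC, h1, h2, formC]

lemma formC_killingForm {V : Type*} [LieRing V] [LieAlgebra ℚ V] [Module.Finite ℚ V] :
    formC (killingForm ℚ V) = killingForm ℂ (ℂ ⊗[ℝ] (ℝ ⊗[ℚ] V)) := by
  have h1 : killingForm ℝ (ℝ ⊗[ℚ] V) = (killingForm ℚ V).baseChange ℝ :=
    LieModule.traceForm_baseChange ℚ V V ℝ
  have h2 : killingForm ℂ (ℂ ⊗[ℝ] (ℝ ⊗[ℚ] V)) = (killingForm ℝ (ℝ ⊗[ℚ] V)).baseChange ℂ :=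
    LieModule.traceForm_baseChange ℝ (ℝ ⊗[ℚ] V) (ℝ ⊗[ℚ] V) ℂ
  rw [h2, h1, formC]

end HodgeStructure

namespace IsLieConjugation

variable {g : Type*} [LieRing g] [LieAlgebra ℂ g] {σ : g →ₛₗ[starRingEnd ℂ] g}
  (hσ : IsLieConjugation σ) {V : Type*} [LieRing V] [LieAlgebra ℚ V]
  (E : (ℝ ⊗[ℚ] V) ≃ₗ⁅ℝ⁆ hσ.fixed)

/-- A complex Lie algebra as the complexification of the rational Lie algebra of an integral
form of a real form. -/
def rationalEquiv : (ℂ ⊗[ℝ] (ℝ ⊗[ℚ] V)) ≃ₗ⁅ℂ⁆ g :=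
  lieEquivOfBaseChange ((E.toLinearEquiv.baseChange ℝ ℂ _ _).trans hσ.linearEquiv) fun x y ↦ by
    have h (x) : ((E.toLinearEquiv.baseChange ℝ ℂ _ _).trans hσ.linearEquiv) ((1 : ℂ) ⊗ₜ[ℝ] x) =
        (E x : g) := by
      change (1 : ℂ) • (E x : g) = _
      rw [one_smul]
    rw [h, h, h, LieEquiv.map_lie]
    rfl

lemma rationalEquiv_tmul (c : ℂ) (x : ℝ ⊗[ℚ] V) :
    hσ.rationalEquiv E (c ⊗ₜ x) = c • (E x : g) := rfl

lemma rationalEquiv_conjC (s : ℂ ⊗[ℝ] (ℝ ⊗[ℚ] V)) :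
    hσ.rationalEquiv E (HodgeStructure.conjC _ s) = σ (hσ.rationalEquiv E s) := by
  induction s with
  | zero => simp
  | add s t hs ht => simp only [map_add, hs, ht]
  | tmul c x =>
    rw [HodgeStructure.conjC, LinearMap.rTensor_tmul, rationalEquiv_tmul, rationalEquiv_tmul,
      map_smulₛₗ, apply_coe]
    rfl

lemma formC_killingForm [Module.Finite ℚ V] [FiniteDimensional ℂ g] (s t : ℂ ⊗[ℝ] (ℝ ⊗[ℚ] V)) :
    HodgeStructure.formC (-(killingForm ℚ V)) s t =
      -killingForm ℂ g (hσ.rationalEquiv E s) (hσ.rationalEquiv E t) := by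
  rw [HodgeStructure.formC_neg, HodgeStructure.formC_killingForm, killingForm_of_equiv_apply]
  rfl

variable {ρ : Circle → g →ₗ[ℂ] g} (hs : HodgeStructure V 0)
  (hρ : ∀ z v, (E (hs.φ z v) : g) = ρ z (E v))

include hρ in
lemma rationalEquiv_φC (z : Circle) (s : ℂ ⊗[ℝ] (ℝ ⊗[ℚ] V)) :
    hσ.rationalEquiv E (hs.φC z s) = ρ z (hσ.rationalEquiv E s) := by
  induction s with
  | zero => simp
  | add s t hs ht => simp only [map_add, hs, ht]
  | tmul c x =>
    rw [HodgeStructure.φC, LinearMap.baseChange_tmul, rationalEquiv_tmul, rationalEquiv_tmul,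
      map_smul, ← hρ]
    rfl

include hρ in
/-- A Hodge structure of weight zero on a rational Lie algebra is polarized by the negative of the
Killing form if the circle acts by isometries and the associated Hermitian form is definite. -/
theorem isPolarizedBy [Module.Finite ℚ V] [FiniteDimensional ℂ g]
    (hinv : ∀ z x y, killingForm ℂ g (ρ z x) (ρ z y) = killingForm ℂ g x y)
    (hpos : ∀ z : Circle, (z : ℂ) = Complex.I → ∀ x, x ≠ 0 →
      ∃ r : ℝ, killingForm ℂ g x (ρ z (σ x)) = -(r : ℂ) ∧ 0 < r) :
    hs.IsPolarizedBy (-(killingForm ℚ V)) := by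
  have hsymm (u v : V) : killingForm ℚ V u v = killingForm ℚ V v u :=
    LieModule.traceForm_comm ..
  have hrel2 (z : Circle) (hz : (z : ℂ) = Complex.I) (v : ℂ ⊗[ℝ] (ℝ ⊗[ℚ] V))
      (hv : v ≠ 0) : ∃ r : ℝ, HodgeStructure.formC (-(killingForm ℚ V)) v
        (hs.φC z (HodgeStructure.conjC _ v)) = r ∧ 0 < r := by
    obtain ⟨r, hr, hr0⟩ := hpos z hz (hσ.rationalEquiv E v) fun h ↦
      hv ((hσ.rationalEquiv E).injective (h.trans (map_zero _).symm))
    refine ⟨r, ?_, hr0⟩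
    rw [hσ.formC_killingForm E, hσ.rationalEquiv_φC E hs hρ, rationalEquiv_conjC, hr, neg_neg]
  -- Nondegeneracy over `ℚ` comes from positivity over `ℂ`: a nonzero radical vector would stay
  -- nonzero after the faithfully flat base changes, yet pair to zero with everything.
  have hsep (u : V) (hu : ∀ v, killingForm ℚ V u v = 0) : u = 0 := by
    by_contra hu0
    have hne : (1 : ℂ) ⊗ₜ[ℝ] ((1 : ℝ) ⊗ₜ[ℚ] u) ≠ 0 := fun h ↦ hu0 <| by
      have h1 := Module.FaithfullyFlat.tensorProduct_mk_injective (A := ℝ) (B := ℂ)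
        (ℝ ⊗[ℚ] V) (h.trans (TensorProduct.tmul_zero _ _).symm)
      exact Module.FaithfullyFlat.tensorProduct_mk_injective (A := ℚ) (B := ℝ) _
        (h1.trans (TensorProduct.tmul_zero _ _).symm)
    obtain ⟨r, hr, hr0⟩ := hrel2 (Circle.exp (Real.pi / 2)) (by
      rw [Circle.coe_exp]
      push_cast
      exact Complex.exp_pi_div_two_mul_I) _ hne
    have h0 (t) : HodgeStructure.formC (-(killingForm ℚ V))
        ((1 : ℂ) ⊗ₜ[ℝ] ((1 : ℝ) ⊗ₜ[ℚ] u)) t = 0 := by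
      induction t with
      | zero => simp
      | add s t hs ht => rw [map_add, hs, ht, add_zero]
      | tmul c x =>
        induction x with
        | zero => simp
        | add s t hs ht => rw [TensorProduct.tmul_add, map_add, hs, ht, add_zero]
        | tmul d x => simp [HodgeStructure.formC, hu]
    rw [h0] at hr
    exact hr0.ne (Complex.ofReal_injective hr)
  refine ⟨⟨fun u hu ↦ hsep u fun v ↦ ?_, fun u hu ↦ hsep u fun v ↦ ?_⟩, fun u v ↦ ?_,
    fun p u hu v hv ↦ ?_, fun z hz v hv ↦ ?_⟩
  · simpa using hu v
  · rw [hsymm]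
    simpa using hu v
  · simp [hsymm u v]
  · have hpiece (r s : ℤ) (hrs : 0 < r + s) (u v) (hu : u ∈ hs.piece r (0 - r))
        (hv : v ∈ hs.piece s (0 - s)) :
        HodgeStructure.formC (-(killingForm ℚ V)) u v = 0 := by
      rw [hσ.formC_killingForm E, neg_eq_zero]
      -- This point satisfies `z^(2r) z^(2s) = -1`, so invariance equates the pairing with its own
      -- negative. It requires `r + s ≠ 0`; in the first relation `r ≥ p` and `s ≥ 1 - p` give `r +
      -- s ≥ 1`.
      let z : Circle := Circle.exp (Real.pi / (2 * (r + s)))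
      have hz : (z : ℂ) ^ (r - (0 - r)) * (z : ℂ) ^ (s - (0 - s)) = -1 := by
        rw [← zpow_add₀ (Circle.coe_ne_zero z), Circle.coe_exp, ← Complex.exp_int_mul,
          ← Complex.exp_pi_mul_I]
        congr 1
        have hrs' : (r + s : ℂ) ≠ 0 := by exact_mod_cast hrs.ne'
        push_cast
        field_simp
        ring
      have hu' := Module.End.mem_eigenspace_iff.1 ((Submodule.mem_iInf _).1 hu z)
      have hv' := Module.End.mem_eigenspace_iff.1 ((Submodule.mem_iInf _).1 hv z)
      have h := hinv z (hσ.rationalEquiv E u) (hσ.rationalEquiv E v)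
      rw [← hσ.rationalEquiv_φC E hs hρ, ← hσ.rationalEquiv_φC E hs hρ, hu', hv', map_smul,
        map_smul, map_smul, map_smul, LinearMap.smul_apply, smul_smul, mul_comm, hz,
        neg_one_smul] at h
      exact self_eq_neg.1 h.symm
    have hleft (s : ℤ) (hs' : 0 - p + 1 ≤ s) (v) (hv : v ∈ hs.piece s (0 - s)) :
        hs.filtration p ≤
          LinearMap.ker ((HodgeStructure.formC (-(killingForm ℚ V))).flip v) :=
      iSup_le fun r ↦ iSup_le fun hr u hu ↦ hpiece r s (by omega) u v hu hv
    have hright : hs.filtration (0 - p + 1) ≤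
        LinearMap.ker (HodgeStructure.formC (-(killingForm ℚ V)) u) :=
      iSup_le fun s ↦ iSup_le fun hs' v hv ↦ hleft s hs' v hv hu
    exact hright hv
  · obtain ⟨r, hr, hr0⟩ := hrel2 z hz v hv
    rw [hr]
    exact ⟨Complex.ofReal_im r, hr0⟩

end IsLieConjugation

end

/-! ### Assembly -/

noncomputable section
open LieAlgebra LieAlgebra.IsKilling LieModule Module Set

lemma Module.Basis.killingForm_gradingAction {ι g : Type*} [LieRing g] [LieAlgebra ℂ g]
    {v : Basis ι ℂ g} {n : ι → ℤ} {T : g} (hT : ∀ i, ⁅T, v i⁆ = (n i : ℂ) • v i) {z : ℂ}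
    (hz : z ≠ 0) (x y : g) :
    killingForm ℂ g (v.gradingAction n z x) (v.gradingAction n z y) = killingForm ℂ g x y := by
  let f : g ≃ₗ⁅ℂ⁆ g :=
    { toFun := v.gradingAction n z
      map_add' := map_add _
      map_smul' := map_smul _
      map_lie' := gradingAction_lie hT hz _ _
      invFun := v.gradingAction n z⁻¹
      left_inv x := by rw [← gradingAction_mul, inv_mul_cancel₀ hz, gradingAction_one]
      right_inv x := by rw [← gradingAction_mul, mul_inv_cancel₀ hz, gradingAction_one] }
  exact killingForm_of_equiv_apply f x y

namespace LieAlgebra.IsKilling.IsChevalleySystem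

variable {g : Type*} [LieRing g] [LieAlgebra ℂ g] [FiniteDimensional ℂ g]
  [IsKilling ℂ g] {H : LieSubalgebra ℂ g} [H.IsCartanSubalgebra]
  {θ : g →ₗ⁅ℂ⁆ g} {e : Weight ℂ H g → g}
  (C : IsChevalleySystem θ e) (b : (rootSystem H).Base)

lemma exists_basisWeight_eq {T : H} (hT : IsGradingElement H T) :
    ∃ n : b.support ⊕ H.root → ℤ, ∀ i, basisWeight b i T = n i := by
  have h (i : b.support ⊕ H.root) : ∃ m : ℤ, basisWeight b i T = m := by
    rcases i with i | α
    · exact ⟨0, by simp [basisWeight]⟩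
    · exact hT _ (AddSubgroup.subset_closure ⟨α.1, H.isNonZero_coe_root α, rfl⟩)
  choose n hn using h
  exact ⟨n, hn⟩

variable {n : b.support ⊕ H.root → ℤ} {T : H} (hn : ∀ i, basisWeight b i T = n i)

lemma hodgeConj_gradingAction_I (x : g) :
    C.hodgeConj b n ((C.basis b).gradingAction n Complex.I x) = (C.basis b).conj (θ x) := by
  rw [hodgeConj_apply, ← Basis.gradingAction_mul, Complex.I_mul_I, Basis.gradingAction_neg,
    Basis.gradingAction_one]

include hn

/-- The Weil operator undoes the twist: composed with the conjugation of the real form it is the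
compact conjugation. -/
lemma gradingAction_I_hodgeConj (x : g) :
    (C.basis b).gradingAction n Complex.I (C.hodgeConj b n x) = (C.basis b).conj (θ x) := by
  rw [← C.hodgeConj_gradingAction b hn (by simp), hodgeConj_gradingAction_I]

end LieAlgebra.IsKilling.IsChevalleySystem

end

theorem propositionP {g : Type*} [LieRing g] [LieAlgebra ℂ g] [FiniteDimensional ℂ g]
    [LieAlgebra.IsSemisimple ℂ g] (H : LieSubalgebra ℂ g) [H.IsCartanSubalgebra]
    (T : H) (hT : IsGradingElement H T) :
    ∃ (gR : LieSubalgebra ℝ g) (gZ : LieSubalgebra ℤ gR) (hZ : IsIntegralForm gZ)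
      (t k : LieSubalgebra ℝ gR) (q : Submodule ℝ gR),
      IsRealForm gR ∧
      t.IsCartanSubalgebra ∧ complexSpan t.toSubmodule = H.toSubmodule ∧
      IsCartanDecomposition k q ∧ t ≤ k ∧ IsCompactTorus t ∧
      complexSpan k.toSubmodule = evenPart (T : g) ∧
      complexSpan q = oddPart (T : g) ∧
      ∃ (L : gR) (φ : Circle →* adjointGroup gR) (hs : HodgeStructure (ℚ ⊗[ℤ] gZ) 0),
        L ∈ t ∧ (L : g) = (4 * (Real.pi : ℂ) * Complex.I) • (T : g) ∧
        (∀ s : ℝ, IsExp (s • LieAlgebra.ad ℝ gR L)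
          (((φ (Circle.exp (2 * Real.pi * s))) : gR ≃ₗ[ℝ] gR) : gR →ₗ[ℝ] gR)) ∧
        (∀ (z : Circle) (v : ℝ ⊗[ℚ] (ℚ ⊗[ℤ] gZ)),
          hZ.realEquiv (hs.φ z v) = (φ z : gR ≃ₗ[ℝ] gR) (hZ.realEquiv v)) ∧
        hs.IsPolarizedBy (-(killingForm ℚ (ℚ ⊗[ℤ] gZ))) := by
  obtain ⟨θ, e, C⟩ := LieAlgebra.IsKilling.exists_isChevalleySystem (K := ℂ) H
  obtain ⟨b⟩ := (LieAlgebra.IsKilling.rootSystem H).nonempty_base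
  obtain ⟨n, hn⟩ := LieAlgebra.IsKilling.IsChevalleySystem.exists_basisWeight_eq b hT
  have hσ := C.isLieConjugation_hodgeConj b hn
  have hT' := C.lie_basis_eq b hn
  have hlie := Module.Basis.gradingAction_lie hT' Complex.I_ne_zero
  have hI (x : g) : (C.basis b).gradingAction n Complex.I
      ((C.basis b).gradingAction n Complex.I x) = x := by
    rw [← Module.Basis.gradingAction_mul, Complex.I_mul_I, Module.Basis.gradingAction_neg,
      Module.Basis.gradingAction_one]
  have hσI := C.hodgeConj_gradingAction b hn (z := Complex.I) (by simp)
  have hZ := hσ.isIntegralForm (C.basis b) (C.lie_basis_mem b) (C.hodgeConj_basis_mem b n)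
  let hs := hZ.hodgeStructure (C.circleHom b hn) (C.det_circleHom b hn)
    (C.exists_polynomial_circleHom b hn)
    fun z hz ↦ C.circleHom_apply_of_coe_eq_neg_one b hn hz
  have hHσ := C.hodgeConj_mem_cartan b hn
  refine ⟨hσ.fixed, hσ.integralForm (C.basis b) (C.lie_basis_mem b), hZ, hσ.realPart H,
    hσ.fixedPart hlie, hσ.negPart ((C.basis b).gradingAction n Complex.I), hσ.isRealForm,
    hσ.isCartanSubalgebra_realPart hHσ, hσ.complexSpan_realPart hHσ,
    hσ.isCartanDecomposition hlie hI hσI fun x hx ↦ ?_,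
    fun x hx ↦ C.gradingAction_cartan b hn _ hx, C.isCompactTorus b hn,
    hσ.complexSpan_eq _ _ (fun x hx ↦ ?_) fun x ↦ (Module.Basis.mem_evenPart_iff hT' _).symm,
    hσ.complexSpan_eq _ _ (fun x hx ↦ ?_) fun x ↦ (Module.Basis.mem_oddPart_iff hT' _).symm,
    C.generator b hn, (C.circleHom b hn).codRestrict _ (C.circleHom_mem_adjointGroup b hn), hs,
    C.generator_mem b hn, rfl, fun s ↦ ?_, fun z v ↦ hZ.realEquiv_hodgeStructure _ _ _ _ z v, ?_⟩
  -- Definiteness of the compact conjugation is used twice: here for the signs of the Cartan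
  -- decomposition, and at the end for the second bilinear relation.
  · rw [C.hodgeConj_gradingAction_I b]
    exact C.exists_killingForm_conj_involution b x hx
  · rw [Module.Basis.mem_evenPart_iff hT'] at hx ⊢
    rw [← hσI, hx]
  · rw [Module.Basis.mem_oddPart_iff hT'] at hx ⊢
    rw [← hσI, hx, map_neg]
  · rw [← map_smul]
    exact C.isExp_circleHom b hn s
  · have := hZ.finite
    refine hσ.isPolarizedBy hZ.lieEquiv (ρ := fun z ↦ (C.basis b).gradingAction n z) hs
      (fun z v ↦ ?_) (fun z x y ↦ Module.Basis.killingForm_gradingAction hT' (Circle.coe_ne_zero z) x y)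
      fun z hz x hx ↦ ?_
    · exact (congrArg Subtype.val (hZ.realEquiv_hodgeStructure _ _ _ _ z v)).trans
        (C.coe_circleHom_apply b hn z _)
    · rw [hz, C.gradingAction_I_hodgeConj b hn]
      exact C.exists_killingForm_conj_involution b x hx
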